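/- Let $d\ge 1$, $N\ge 2$, and let $\Phi_1,\dots,\Phi_N:\mathbb R^d\to\mathbb R^d$ be similarities with ratios $r_1,\dots,r_N\in(0,1)$. For $A\subseteq\mathbb R^d$ put $\Phi(A)=\bigcup_n\Phi_n(A)$, and let $F$ be the associated self-similar set, i.e. the unique nonempty compact set with $F=\Phi(F)$. The system (or $F$) is called lattice if there are $r>0$ and integers $k_1,\dots,k_N$ with $r_n=r^{k_n}$ for all $n$, and nonlattice otherwise. A feasible open set is a nonempty open set $O$ such that $\Phi_n(O)\subseteq O$ for all $n$ and the sets $\Phi_n(O)$ are pairwise disjoint; $F$ satisfies the open set condition if such an $O$ exists. For $\varepsilon>0$ let $A_\varepsilon=\{x: d(x,A)\le\varepsilon\}$, let $\lambda_d$ be Lebesgue measure, and for open $A$ let $V(A,\varepsilon)=\lambda_d(\{x\in A: d(x,A^c)\le\varepsilon\})$. For $0\le\alpha\le d$ the Minkowski content, the average Minkowski content and the outer Minkowski content of a bounded set $A$ are the following limits, when they exist in $[0,\infty]$: $$\mathcal M_\alpha(A)=\lim_{\varepsilon\to0^+}\frac{\lambda_d(A_\varepsilon)}{\varepsilon^{d-\alpha}},\qquad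 \overline{\mathcal M}_\alpha(A)=\lim_{b\to\infty}\frac1{\log b}\int_{1/b}^1\varepsilon^{-(d-\alpha)}\lambda_d(A_\varepsilon)\,\frac{d\varepsilon}{\varepsilon},\qquad \mathcal M^{\rm out}_\alpha(A)=\lim_{\varepsilon\to0^+}\frac{\lambda_d(A_\varepsilon)-\lambda_d(A)}{\varepsilon^{d-\alpha}}.$$ $A$ is Minkowski measurable if $\mathcal M_\alpha(A)$ exists and lies in $(0,\infty)$ for some $\alpha\in[0,d]$. The Minkowski dimension of $A$ is $\inf\{\alpha\ge0:\mathcal M_\alpha(A)=0\}$, where in this infimum the same limit is used for every $\alpha\ge 0$. For a feasible open set $O$, the generators are the connected components of $O\setminus\Phi(\overline O)$, and the tiling $\mathcal T=\mathcal T(O)$ consists of the sets $\Phi_{w_1}\circ\cdots\circ\Phi_{w_m}(G)$, where $w$ runs through all finite words over $\{1,\dots,N\}$ (including the empty word) and $G$ through all generators. With $T$ the union of all tiles, $\mathcal M_\alpha(\mathcal T)$ and $\overline{\mathcal M}_\alpha(\mathcal T)$ are defined by the first two limits above with $V(T,\varepsilon)$ in place of $\lambda_d(A_\varepsilon)$.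 A bounded open set $G$ with inradius $g>0$ (the maximal radius of a ball contained in $G$) is monophase if there are constants $\kappa_0,\dots,\kappa_d\in\mathbb R$ with $V(G,\varepsilon)=\sum_{k=0}^d\kappa_k\varepsilon^{d-k}$ for $0<\varepsilon\le g$. These constants are then unique, and one puts $\Gamma_s(G)=\sum_{k=0}^{d-1}\frac{g^{s-k}}{s-k}(d-k)\kappa_k$. **Theorem.** Let $F$ be a self-similar set in $\mathbb R^d$ which satisfies the open set condition and has Minkowski dimension $D\in(d-1,d)$. Assume that there is a feasible open set $O$ with $\partial O\subseteq F$ such that the tiling $\mathcal T=\mathcal T(O)$ has exactly one generator $G$, that $G$ is monophase, and that for $K=\overline O$ the outer Minkowski content $\mathcal M^{\rm out}_D(K)$ exists and satisfies $0\le\mathcal M^{\rm out}_D(K)<\infty$. Then $F$ is Minkowski measurable if and only if $F$ is nonlattice. In the nonlattice case, $\mathcal M_D(F)$ and $\mathcal M_D(\mathcal T)$ exist, both lie in $(0,\infty)$, and $$\mathcal M_D(F)=\mathcal M_D(\mathcal T)+\mathcal M^{\rm out}_D(K).$$ In the lattice case, $\mathcal M_D(F)$ does not exist (not even as a value in $[0,\infty]$),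 but the average Minkowski contents $\overline{\mathcal M}_D(F)$ and $\overline{\mathcal M}_D(\mathcal T)$ exist, both lie in $(0,\infty)$, and $$\overline{\mathcal M}_D(F)=\overline{\mathcal M}_D(\mathcal T)+\mathcal M^{\rm out}_D(K),\qquad \overline{\mathcal M}_D(\mathcal T)=\frac{\Gamma_D(G)}{(d-D)\sum_{n=1}^N r^{k_nD}\,k_n\log r^{-1}},$$ for all $r>0$ and integers $k_n$ with $r_n=r^{k_n}$ $(n=1,\dots,N)$. -/

import Mathlib

open Set Filter Topology MeasureTheory
open scoped ENNReal NNReal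

noncomputable section

/-! ### Minkowski contents of volume functions and of sets -/

/-- For a volume function `V` (of the parallel radius) in dimension `d`, the limit of
`V ε / ε ^ (d - α)` as `ε → 0+` exists in `[0, ∞]` and equals `c`. -/
def HasContent (d : ℕ) (α : ℝ) (V : ℝ → ℝ≥0∞) (c : ℝ≥0∞) : Prop :=
  Tendsto (fun ε : ℝ => V ε / ENNReal.ofReal (ε ^ ((d : ℝ) - α))) (𝓝[>] (0 : ℝ)) (𝓝 c)

/-- The logarithmic average `(1 / log b) * ∫_{1/b}^1 ε ^ (-(d - α)) * V ε dε / ε` has a limit in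
`[0, ∞]` as `b → ∞`, and this limit is `c`. -/
def HasAverageContent (d : ℕ) (α : ℝ) (V : ℝ → ℝ≥0∞) (c : ℝ≥0∞) : Prop :=
  Tendsto
    (fun b : ℝ =>
      (∫⁻ ε in Icc (1 / b) 1,
        ENNReal.ofReal (ε ^ (-((d : ℝ) - α))) * V ε * ENNReal.ofReal (1 / ε)) /
        ENNReal.ofReal (Real.log b))
    atTop (𝓝 c)

/-- `λ_d(A_ε)`, where `A_ε = {x | d(x, A) ≤ ε}` is the closed `ε`-parallel set. -/
def parallelVolume {d : ℕ} (A : Set (EuclideanSpace ℝ (Fin d))) (ε : ℝ) : ℝ≥0∞ :=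
  volume (Metric.cthickening ε A)

/-- `λ_d(A_ε) - λ_d(A)`. -/
def outerParallelVolume {d : ℕ} (A : Set (EuclideanSpace ℝ (Fin d))) (ε : ℝ) : ℝ≥0∞ :=
  volume (Metric.cthickening ε A) - volume A

/-- `V(A, ε)`, the volume of the inner parallel set `{x ∈ A | d(x, Aᶜ) ≤ ε}`. -/
def innerParallelVolume {d : ℕ} (A : Set (EuclideanSpace ℝ (Fin d))) (ε : ℝ) : ℝ≥0∞ :=
  volume (A ∩ Metric.cthickening ε Aᶜ)

/-- The `α`-dimensional Minkowski content of the set `A` exists in `[0, ∞]` and equals `c`. -/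
def HasMinkowskiContent {d : ℕ} (α : ℝ) (A : Set (EuclideanSpace ℝ (Fin d))) (c : ℝ≥0∞) : Prop :=
  HasContent d α (parallelVolume A) c

/-- The `α`-dimensional average Minkowski content of the set `A` exists and equals `c`. -/
def HasAverageMinkowskiContent {d : ℕ} (α : ℝ) (A : Set (EuclideanSpace ℝ (Fin d)))
    (c : ℝ≥0∞) : Prop :=
  HasAverageContent d α (parallelVolume A) c

/-- The outer `α`-dimensional Minkowski content of the set `A` exists and equals `c`. -/
def HasOuterMinkowskiContent {d : ℕ} (α : ℝ) (A : Set (EuclideanSpace ℝ (Fin d)))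
    (c : ℝ≥0∞) : Prop :=
  HasContent d α (outerParallelVolume A) c

/-- `A` is Minkowski measurable: for some `α ∈ [0, d]`, its `α`-dimensional Minkowski content
exists and lies in `(0, ∞)`. (Then `α` is necessarily the Minkowski dimension of `A`.) -/
def IsMinkowskiMeasurable {d : ℕ} (A : Set (EuclideanSpace ℝ (Fin d))) : Prop :=
  ∃ α : ℝ, 0 ≤ α ∧ α ≤ d ∧ ∃ c : ℝ≥0∞, HasMinkowskiContent α A c ∧ 0 < c ∧ c < ∞

/-- The Minkowski dimension `inf {α ≥ 0 | the α-dimensional Minkowski content of A is 0}`. -/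
def minkowskiDim {d : ℕ} (A : Set (EuclideanSpace ℝ (Fin d))) : ℝ :=
  sInf {α : ℝ | 0 ≤ α ∧ HasMinkowskiContent α A 0}

/-! ### Monophase open sets -/

/-- The inradius: the maximal radius of a ball contained in `G`. -/
def inradius {d : ℕ} (G : Set (EuclideanSpace ℝ (Fin d))) : ℝ :=
  sSup {ρ : ℝ | ∃ x, Metric.ball x ρ ⊆ G}

/-- `V(G, ε) = ∑_{k = 0}^d κ_k ε ^ (d - k)` for `0 < ε ≤ inradius G`, with constant coefficients
`κ_0, …, κ_d`. -/
def IsMonophaseRepresentation {d : ℕ} (G : Set (EuclideanSpace ℝ (Fin d)))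
    (κ : Fin (d + 1) → ℝ) : Prop :=
  ∀ ε : ℝ, 0 < ε → ε ≤ inradius G →
    (innerParallelVolume G ε).toReal = ∑ k : Fin (d + 1), κ k * ε ^ (d - (k : ℕ))

/-- `G` is monophase. -/
def IsMonophase {d : ℕ} (G : Set (EuclideanSpace ℝ (Fin d))) : Prop :=
  ∃ κ : Fin (d + 1) → ℝ, IsMonophaseRepresentation G κ

/-- `Γ_s(G) = ∑_{k = 0}^{d - 1} g ^ (s - k) / (s - k) * (d - k) * κ_k` for real `s`, where `g` is
the inradius of `G` and `κ` is the coefficient vector of the monophase representation of `G`. -/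
def gammaCoeff {d : ℕ} (G : Set (EuclideanSpace ℝ (Fin d))) (κ : Fin (d + 1) → ℝ) (s : ℝ) : ℝ :=
  ∑ k : Fin d, inradius G ^ (s - (k : ℕ)) / (s - (k : ℕ)) * ((d : ℝ) - (k : ℕ)) * κ k.castSucc

/-! ### Self-similar systems, feasible open sets and self-similar tilings -/

/-- An iterated function system of `N ≥ 2` contractive similarities of `ℝ^d`, with scaling ratios
in `(0, 1)`. -/
structure SelfSimilarSystem (d N : ℕ) where
  map : Fin N → EuclideanSpace ℝ (Fin d) → EuclideanSpace ℝ (Fin d)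
  ratio : Fin N → ℝ
  two_le : 2 ≤ N
  ratio_pos : ∀ n, 0 < ratio n
  ratio_lt_one : ∀ n, ratio n < 1
  dist_map : ∀ n x y, dist (map n x) (map n y) = ratio n * dist x y

namespace SelfSimilarSystem

/-- The set map `S(A) = ⋃ n, S_n(A)`. -/
def setMap {d N : ℕ} (S : SelfSimilarSystem d N) (A : Set (EuclideanSpace ℝ (Fin d))) :
    Set (EuclideanSpace ℝ (Fin d)) :=
  ⋃ n, S.map n '' A

/-- `F` is the self-similar set of `S`: the (unique) nonempty compact set with `S(F) = F`. -/
def IsAttractor {d N : ℕ} (S : SelfSimilarSystem d N) (F : Set (EuclideanSpace ℝ (Fin d))) :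
    Prop :=
  F.Nonempty ∧ IsCompact F ∧ F = S.setMap F

/-- `O` is a feasible open set for the open set condition. -/
def IsFeasible {d N : ℕ} (S : SelfSimilarSystem d N) (O : Set (EuclideanSpace ℝ (Fin d))) :
    Prop :=
  O.Nonempty ∧ IsOpen O ∧ (∀ n, S.map n '' O ⊆ O) ∧
    ∀ n m, n ≠ m → Disjoint (S.map n '' O) (S.map m '' O)

/-- `S_w = S_{w_1} ∘ ⋯ ∘ S_{w_m}` for a finite word `w`; the empty word gives the identity. -/
def wordMap {d N : ℕ} (S : SelfSimilarSystem d N) :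
    List (Fin N) → EuclideanSpace ℝ (Fin d) → EuclideanSpace ℝ (Fin d)
  | [] => id
  | n :: w => S.map n ∘ S.wordMap w

/-- The generators: the connected components of `O \ S(closure O)`. -/
def generators {d N : ℕ} (S : SelfSimilarSystem d N) (O : Set (EuclideanSpace ℝ (Fin d))) :
    Set (Set (EuclideanSpace ℝ (Fin d))) :=
  {G | ∃ x ∈ O \ S.setMap (closure O), G = connectedComponentIn (O \ S.setMap (closure O)) x}

/-- The self-similar tiling `{S_w(G) | w a finite word, G a generator}` associated with `O`. -/
def tiling {d N : ℕ} (S : SelfSimilarSystem d N) (O : Set (EuclideanSpace ℝ (Fin d))) :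
    Set (Set (EuclideanSpace ℝ (Fin d))) :=
  {R | ∃ w : List (Fin N), ∃ G ∈ S.generators O, R = S.wordMap w '' G}

/-- The system is lattice: all scaling ratios are integer powers of one number `r > 0`. -/
def IsLattice {d N : ℕ} (S : SelfSimilarSystem d N) : Prop :=
  ∃ r : ℝ, 0 < r ∧ ∀ n, ∃ k : ℤ, S.ratio n = r ^ k

end SelfSimilarSystem

/-- The `α`-dimensional Minkowski content of a tiling (a family of open sets) exists and equals
`c`; it is computed from the inner parallel volume of the union of the tiles. -/
def HasTilingMinkowskiContent {d : ℕ} (α : ℝ) (T : Set (Set (EuclideanSpace ℝ (Fin d))))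
    (c : ℝ≥0∞) : Prop :=
  HasContent d α (innerParallelVolume (⋃₀ T)) c

/-- The `α`-dimensional average Minkowski content of a tiling exists and equals `c`. -/
def HasTilingAverageMinkowskiContent {d : ℕ} (α : ℝ) (T : Set (Set (EuclideanSpace ℝ (Fin d))))
    (c : ℝ≥0∞) : Prop :=
  HasAverageContent d α (innerParallelVolume (⋃₀ T)) c

end

/-!
The proof compares parallel volumes in logarithmic scale: for a volume function `V` put
`logScale γ V t = exp (γ t) * V (exp (-t))` with `γ = d - D`, so that a Minkowski content is a limit
as `t → ∞` and an average Minkowski content is the limit of an integral mean.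

*Geometry.* Since the frontiers of `O`, of the generator `G` and of all tiles lie in `F`, a path
leaving one of these sets meets `F` (`infEDist_le_of_frontier_subset`). Hence inside a tile the
distance to the complement of the tiling is the distance to `F`, and outside `closure O` the distance
to `closure O` is the distance to `F`. As the tiles exhaust `closure O` up to a null set, the parallel
volume of `F` is exactly the inner parallel volume of the tiling plus the outer parallel volume of
`closure O` (`parallelVolume_eq`). It remains to study the tiling, whose rescaled volume `Z`
satisfies the renewal equation `Z t = z t + ∑ n, r_n ^ D * Z (t + log r_n)` with the rescaled volume
`z` of `G` as source. Comparison with this equation also shows that the volumes for `F` and for the tiling have order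
`ε ^ (d - s)`, where `∑ n, r_n ^ s = 1`; this identifies `D` with `s` (`minkowskiDim_eq`) and
leaves `D` as the only dimension in which the content of `F` can be positive and finite.

*Renewal theory.* Integrating the equation over `(-∞, T]` gives
`∑ n, p n * ∫ t in (T - a n)..T, Z t = ∫ t in Iic T, z t` (`sum_window_eq`), where `p n = r_n ^ D` and
`a n = -log r_n`. Averaging over `T` yields the mean of `Z`, namely `(∫ z) / ∑ n, p n * a n`, in all
cases (`tendsto_mean`). In the nonlattice case the `a n` generate a dense group. Where `Z` is near its
upper limit `c`, the equation forces it to be close to `c` also at all shifts by sums of the `a n`,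
hence, because `exp (-γ t) * Z t` is nonincreasing, on whole windows; the window identity then bounds
`c` by the mean. The same argument for the lower limit gives convergence (`tendsto_of_dense`).

*Lattice case.* If all `a n` are multiples of `h₀` and `Z` converged, the discrete analogue of the
window identity would express `∑ k ≥ 1, z (t + k * h₀)` as a constant minus `B * exp (γ t)` with
`B > 0`. For a monophase generator the sum is a combination of the exponentials `exp (-(D - j) t)`,
`j < d`, and no such identity can hold on an interval, by analytic continuation to `t → ∞`
(`not_tendsto_of_exp_source`). Finally `∫ z` is computed from the monophase representation
(`integral_generator`).
-/

/-! ### The renewal equation -/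

/-- `Z` solves the renewal equation `Z t = z t + ∑ n, p n * Z (t - a n)` for the probability
vector `p` and the positive step lengths `a`. The remaining fields are the regularity that
parallel volumes provide: `Z` is nonnegative and bounded, `exp (-γ t) * Z t` is nonincreasing, and
`Z` is integrable towards `-∞`; the source `z` is integrable and vanishes at `∞`. -/
structure IsRenewalSolution {ι : Type*} [Fintype ι] (p a : ι → ℝ) (γ : ℝ) (z Z : ℝ → ℝ) :
    Prop where
  weight_pos : ∀ n, 0 < p n
  weight_sum : ∑ n, p n = 1
  step_pos : ∀ n, 0 < a n
  rate_pos : 0 < γ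
  nonneg : ∀ t, 0 ≤ Z t
  bounded : ∃ C, ∀ t, Z t ≤ C
  growth : ∀ t s, 0 ≤ s → Z (t + s) ≤ Real.exp (γ * s) * Z t
  integrableOn : ∀ T, IntegrableOn Z (Iic T)
  source_integrable : Integrable z
  source_tendsto : Tendsto z atTop (𝓝 0)
  equation : ∀ t, Z t = z t + ∑ n, p n * Z (t - a n)

/-- The integral mean of a convergent function converges to the same limit. -/
theorem tendsto_integral_mean {f : ℝ → ℝ} {L : ℝ} (hf : ∀ a b, IntervalIntegrable f volume a b)
    (hL : Tendsto f atTop (𝓝 L)) :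
    Tendsto (fun T => (∫ t in (0 : ℝ)..T, f t) / T) atTop (𝓝 L) := by
  rw [Metric.tendsto_atTop]
  intro η hη
  obtain ⟨T₀, hT₀⟩ := (Metric.tendsto_atTop.1 hL) (η / 2) (by positivity)
  set T₁ := max T₀ 1
  set M := |∫ t in (0 : ℝ)..T₁, (f t - L)|
  refine ⟨max T₁ (4 * M / η + 1), fun T hT => ?_⟩
  have hT1 : T₁ ≤ T := (le_max_left _ _).trans hT
  have hT2 : 4 * M / η + 1 ≤ T := (le_max_right _ _).trans hT
  have hTpos : 0 < T := lt_of_lt_of_le (by positivity : (0 : ℝ) < 4 * M / η + 1) hT2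
  have hg : ∀ a b, IntervalIntegrable (fun t => f t - L) volume a b :=
    fun a b => (hf a b).sub intervalIntegrable_const
  have h1 : ∫ t in (0 : ℝ)..T, (f t - L) = (∫ t in (0 : ℝ)..T, f t) - T * L := by
    rw [intervalIntegral.integral_sub (hf _ _) intervalIntegrable_const]
    simp
  have h2 : |∫ t in T₁..T, (f t - L)| ≤ η / 2 * |T - T₁| := by
    rw [← Real.norm_eq_abs]
    refine intervalIntegral.norm_integral_le_of_norm_le_const fun x hx => ?_
    rw [uIoc_of_le hT1] at hx
    have := hT₀ x ((le_max_left _ _).trans hx.1.le)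
    rw [Real.dist_eq] at this
    exact this.le
  have h3 := intervalIntegral.integral_add_adjacent_intervals (hg 0 T₁) (hg T₁ T)
  have h4 : |(∫ t in (0 : ℝ)..T, f t) - T * L| ≤ M + η / 2 * T := by
    rw [← h1, ← h3]
    refine (abs_add_le _ _).trans (add_le_add le_rfl (h2.trans ?_))
    rw [abs_of_nonneg (by linarith)]
    have : 0 ≤ T₁ := le_trans zero_le_one (le_max_right _ _)
    nlinarith
  have h5 : M < η / 4 * T + η / 4 * T := by
    have : 4 * M / η < T := by linarith
    rw [div_lt_iff₀ hη] at this
    nlinarith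
  rw [Real.dist_eq]
  have h6 : (∫ t in (0 : ℝ)..T, f t) / T - L = ((∫ t in (0 : ℝ)..T, f t) - T * L) / T := by
    field_simp
  rw [h6, abs_div, abs_of_pos hTpos, div_lt_iff₀ hTpos]
  linarith

namespace IsRenewalSolution

variable {ι : Type*} [Fintype ι] {p a : ι → ℝ} {γ : ℝ} {z Z : ℝ → ℝ}

theorem nonempty (h : IsRenewalSolution p a γ z Z) : Nonempty ι := by
  by_contra hne
  rw [not_nonempty_iff] at hne
  simpa using h.weight_sum

theorem mean_pos (h : IsRenewalSolution p a γ z Z) : 0 < ∑ n, p n * a n := by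
  have := h.nonempty
  exact Finset.sum_pos (fun n _ => mul_pos (h.weight_pos n) (h.step_pos n)) Finset.univ_nonempty

theorem intervalIntegrable (h : IsRenewalSolution p a γ z Z) (u v : ℝ) :
    IntervalIntegrable Z volume u v :=
  ⟨(h.integrableOn v).mono_set Ioc_subset_Iic_self, (h.integrableOn u).mono_set Ioc_subset_Iic_self⟩

/-- Integrating the renewal equation over `(-∞, T]` telescopes into an identity between a
weighted integral of `Z` over a window of bounded length and the accumulated source. -/
theorem sum_window_eq (h : IsRenewalSolution p a γ z Z) (T : ℝ) :
    ∑ n, p n * ∫ t in (T - a n)..T, Z t = ∫ t in Iic T, z t := by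
  have hpre : ∀ n, (fun t : ℝ => t - a n) ⁻¹' Iic (T - a n) = Iic T := by
    intro n; ext t; simp
  have hshift : ∀ n, ∫ t in Iic T, Z (t - a n) = ∫ t in Iic (T - a n), Z t := by
    intro n
    rw [← hpre n]
    exact (measurePreserving_sub_right volume (a n)).setIntegral_preimage_emb
      (measurableEmbedding_subRight (a n)) Z _
  have hshiftInt : ∀ n, IntegrableOn (fun t => Z (t - a n)) (Iic T) := by
    intro n
    rw [← hpre n]
    exact ((measurePreserving_sub_right volume (a n)).integrableOn_comp_preimage
      (measurableEmbedding_subRight (a n))).2 (h.integrableOn _)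
  have hmain : ∫ t in Iic T, Z t
      = (∫ t in Iic T, z t) + ∑ n, p n * ∫ t in Iic (T - a n), Z t := by
    rw [show (∫ t in Iic T, Z t) = ∫ t in Iic T, (z t + ∑ n, p n * Z (t - a n)) from
      integral_congr_ae (ae_of_all _ fun t => h.equation t)]
    rw [integral_add h.source_integrable.integrableOn
      (integrable_finsetSum _ fun n _ => (hshiftInt n).const_mul _),
      integral_finsetSum _ fun n _ => (hshiftInt n).const_mul _]
    simp only [integral_const_mul, hshift]
  have hsub : ∀ n, ∫ t in (T - a n)..T, Z t
      = (∫ t in Iic T, Z t) - ∫ t in Iic (T - a n), Z t := fun n =>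
    (intervalIntegral.integral_Iic_sub_Iic (h.integrableOn _) (h.integrableOn _)).symm
  simp only [hsub, mul_sub, Finset.sum_sub_distrib, ← Finset.sum_mul, h.weight_sum, one_mul]
  linarith

theorem tendsto_sum_window (h : IsRenewalSolution p a γ z Z) :
    Tendsto (fun T => ∑ n, p n * ∫ t in (T - a n)..T, Z t) atTop (𝓝 (∫ t, z t)) := by
  simp only [h.sum_window_eq]
  exact (aecover_Iic tendsto_id).integral_tendsto_of_countably_generated h.source_integrable

/-- The renewal theorem in the mean, valid for all step lengths. -/
theorem tendsto_mean (h : IsRenewalSolution p a γ z Z) :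
    Tendsto (fun T => (∫ t in (0 : ℝ)..T, Z t) / T) atTop
      (𝓝 ((∫ t, z t) / ∑ n, p n * a n)) := by
  obtain ⟨C, hC⟩ := h.bounded
  have hμ := h.mean_pos
  set μ := ∑ n, p n * a n with hμdef
  set K : ℝ → ℝ := fun T => ∫ t in (0 : ℝ)..T, Z t with hK
  have hKcont : Continuous K := intervalIntegral.continuous_primitive h.intervalIntegrable 0
  have hKint : ∀ u v, IntervalIntegrable K volume u v := fun u v => hKcont.intervalIntegrable u v
  have hKsub : ∀ u v, K v - K u = ∫ t in u..v, Z t := fun u v =>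
    intervalIntegral.integral_interval_sub_left (h.intervalIntegrable _ _)
      (h.intervalIntegrable _ _)
  have hKlip : ∀ u v, |K v - K u| ≤ C * |v - u| := by
    intro u v
    rw [hKsub, ← Real.norm_eq_abs]
    refine intervalIntegral.norm_integral_le_of_norm_le_const fun x _ => ?_
    rw [Real.norm_of_nonneg (h.nonneg x)]
    exact hC x
  set W : ℝ → ℝ := fun T => ∑ n, p n * ∫ t in (T - a n)..T, Z t with hW
  have hWK : W = fun t => ∑ n, p n * (K t - K (t - a n)) := by
    funext t; simp only [hW, hKsub]
  have hWcont : Continuous W := by rw [hWK]; fun_prop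
  have hWmean := tendsto_integral_mean (fun u v => hWcont.intervalIntegrable u v)
    h.tendsto_sum_window
  have hshift : ∀ n T, ∫ t in (0 : ℝ)..T, K (t - a n) = ∫ t in (-a n)..(T - a n), K t := by
    intro n T
    rw [intervalIntegral.integral_comp_sub_right]
    simp
  have hWint : ∀ T, ∫ t in (0 : ℝ)..T, W t
      = ∑ n, p n * ((∫ t in (0 : ℝ)..(-a n), K t) - ∫ t in T..(T - a n), K t) := by
    intro T
    rw [hWK, intervalIntegral.integral_finsetSum
      fun n _ => (Continuous.intervalIntegrable (by fun_prop) _ _)]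
    refine Finset.sum_congr rfl fun n _ => ?_
    rw [intervalIntegral.integral_const_mul, intervalIntegral.integral_sub (hKint _ _)
      (Continuous.intervalIntegrable (by fun_prop) _ _), hshift,
      intervalIntegral.integral_interval_sub_interval_comm (hKint _ _) (hKint _ _) (hKint _ _)]
  -- `K` varies by at most `C * a n` on the `n`-th window, so up to a bounded error each window
  -- integral of `K` is `a n * K T`.
  set E := ∑ n, p n * (|∫ t in (0 : ℝ)..(-a n), K t| + C * a n * a n) with hE
  have hbound : ∀ T, |(∫ t in (0 : ℝ)..T, W t) - μ * K T| ≤ E := by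
    intro T
    rw [hWint, hμdef, Finset.sum_mul, ← Finset.sum_sub_distrib]
    refine (Finset.abs_sum_le_sum_abs _ _).trans (Finset.sum_le_sum fun n _ => ?_)
    have hp := h.weight_pos n
    have ha := h.step_pos n
    have hconst : ∫ t in T..(T - a n), (K t - K T)
        = (∫ t in T..(T - a n), K t) + a n * K T := by
      rw [intervalIntegral.integral_sub (hKint _ _) intervalIntegrable_const]
      simp
    have hsmall : |∫ t in T..(T - a n), (K t - K T)| ≤ C * a n * a n := by
      have := intervalIntegral.norm_integral_le_of_norm_le_const (a := T) (b := T - a n)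
        (f := fun t => K t - K T) (C := C * a n) (fun x hx => ?_)
      · rwa [Real.norm_eq_abs, show T - a n - T = -a n by ring, abs_neg, abs_of_pos ha] at this
      · rw [uIoc_of_ge (by linarith)] at hx
        refine (hKlip T x).trans ?_
        have hC0 : 0 ≤ C := (h.nonneg 0).trans (hC 0)
        refine mul_le_mul_of_nonneg_left ?_ hC0
        rw [abs_le]
        constructor <;> linarith [hx.1, hx.2]
    have : p n * ((∫ t in (0 : ℝ)..(-a n), K t) - ∫ t in T..(T - a n), K t) - p n * a n * K T
        = p n * ((∫ t in (0 : ℝ)..(-a n), K t) - ∫ t in T..(T - a n), (K t - K T)) := by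
      rw [hconst]; ring
    rw [this, abs_mul, abs_of_pos hp]
    refine mul_le_mul_of_nonneg_left ((abs_sub _ _).trans ?_) hp.le
    gcongr
  have herr : Tendsto (fun T => ((∫ t in (0 : ℝ)..T, W t) - μ * K T) / T) atTop (𝓝 0) := by
    refine squeeze_zero_norm' (a := fun T => E / T) ?_ (tendsto_const_nhds.div_atTop tendsto_id)
    filter_upwards [eventually_gt_atTop 0] with T hT
    rw [Real.norm_eq_abs, abs_div, abs_of_pos hT]
    gcongr
    exact hbound T
  have := (hWmean.sub herr).div_const μ
  rw [sub_zero] at this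
  refine this.congr fun T => ?_
  field_simp
  ring

end IsRenewalSolution

/-- Maximum principle along a filter: where `Y` asymptotically attains an asymptotic upper
bound `c`, the renewal equation with vanishing source forces `Y (t - x)` to be close to `c` as
well, for every sum `x` of step lengths. -/
theorem tendsto_sub_of_mem_closure {ι : Type*} [Fintype ι] {p a : ι → ℝ} {y Y : ℝ → ℝ}
    (hp : ∀ n, 0 < p n) (hsum : ∑ n, p n = 1) (hy : Tendsto y atTop (𝓝 0))
    (heq : ∀ t, Y t = y t + ∑ n, p n * Y (t - a n)) {c : ℝ}
    (hc : ∀ δ > 0, ∀ᶠ t in atTop, Y t ≤ c + δ) {l : Filter ℝ} (hl : l ≤ atTop)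
    (hYl : Tendsto Y l (𝓝 c)) {x : ℝ} (hx : x ∈ AddSubmonoid.closure (range a)) :
    Tendsto (fun t => Y (t - x)) l (𝓝 c) := by
  classical
  have key : ∀ u : ℝ → ℝ, Tendsto u l atTop → Tendsto (fun t => Y (u t)) l (𝓝 c) →
      Tendsto (fun t => Y (u t - x)) l (𝓝 c) := by
    induction hx using AddSubmonoid.closure_induction with
    | mem x hx =>
      obtain ⟨n, rfl⟩ := hx
      intro u hu hYu
      rw [Metric.tendsto_nhds]
      intro η hη
      have hpn := hp n
      have hδ : 0 < p n * η / 4 := by positivity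
      have hsub : ∀ m, Tendsto (fun t => u t - a m) l atTop := fun m =>
        tendsto_atTop_add_const_right l (-a m) hu
      have e1 : ∀ᶠ t in l, ∀ m, Y (u t - a m) ≤ c + p n * η / 4 :=
        eventually_all.2 fun m => (hsub m).eventually (hc _ hδ)
      have e2 : ∀ᶠ t in l, Y (u t - a n) ≤ c + η / 2 := (hsub n).eventually (hc _ (by positivity))
      have e3 : ∀ᶠ t in l, |y (u t)| < p n * η / 4 := by
        have := Metric.tendsto_nhds.1 (hy.comp hu) _ hδ
        simpa [Real.dist_eq] using this
      have e4 : ∀ᶠ t in l, |Y (u t) - c| < p n * η / 4 := by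
        have := Metric.tendsto_nhds.1 hYu _ hδ
        simpa [Real.dist_eq] using this
      filter_upwards [e1, e2, e3, e4] with t h1 h2 h3 h4
      have h5 : ∑ m ∈ Finset.univ.erase n, p m * Y (u t - a m)
          ≤ ∑ m ∈ Finset.univ.erase n, p m * (c + p n * η / 4) :=
        Finset.sum_le_sum fun m _ => mul_le_mul_of_nonneg_left (h1 m) (hp m).le
      have h6 : p n + ∑ m ∈ Finset.univ.erase n, p m = 1 := by
        rw [← hsum]; exact Finset.add_sum_erase _ _ (Finset.mem_univ n)
      have h7 := heq (u t)
      rw [← Finset.add_sum_erase _ _ (Finset.mem_univ n)] at h7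
      rw [← Finset.sum_mul] at h5
      have h8 : ∑ m ∈ Finset.univ.erase n, p m = 1 - p n := by linarith
      rw [h8] at h5
      have hple : 0 ≤ p n * (p n * η / 4) := by positivity
      have h9 : p n * (c - η) < p n * Y (u t - a n) := by
        have := abs_lt.1 h3
        have := abs_lt.1 h4
        nlinarith
      have h10 := lt_of_mul_lt_mul_left h9 hpn.le
      rw [Real.dist_eq, abs_lt]
      constructor <;> linarith
    | zero => intro u _ hYu; simpa using hYu
    | add x x' _ _ ihx ihx' =>
      intro u hu hYu
      have := ihx' (fun t => u t - x) (tendsto_atTop_add_const_right l (-x) hu) (ihx u hu hYu)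
      simpa [sub_sub] using this
  exact key id hl hYl

/-- If `s` generates a dense subgroup of `ℝ`, then the sums of elements of `s` contain arithmetic
progressions that are arbitrarily fine and arbitrarily long. -/
theorem exists_fine_progression {s : Set ℝ} (hs : Dense (AddSubgroup.closure s : Set ℝ))
    {η : ℝ} (hη : 0 < η) (A : ℝ) :
    ∃ (L g : ℝ) (J : ℕ), 0 < g ∧ g ≤ η ∧ A ≤ J * g ∧
      ∀ j : ℕ, j ≤ J → L + j * g ∈ AddSubmonoid.closure s := by
  obtain ⟨g, hg, hgs⟩ := hs.exists_mem_open isOpen_Ioo (nonempty_Ioo.2 hη)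
  have hdiff : ∃ x ∈ AddSubmonoid.closure s, ∃ y ∈ AddSubmonoid.closure s, g = x - y := by
    clear hgs
    induction hg using AddSubgroup.closure_induction with
    | mem x hx => exact ⟨x, AddSubmonoid.subset_closure hx, 0, zero_mem _, by simp⟩
    | zero => exact ⟨0, zero_mem _, 0, zero_mem _, by simp⟩
    | add x x' _ _ h h' =>
      obtain ⟨u, hu, v, hv, rfl⟩ := h
      obtain ⟨u', hu', v', hv', rfl⟩ := h'
      exact ⟨u + u', add_mem hu hu', v + v', add_mem hv hv', by ring⟩
    | neg x _ h =>
      obtain ⟨u, hu, v, hv, rfl⟩ := h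
      exact ⟨v, hv, u, hu, by ring⟩
  obtain ⟨x, hx, y, hy, hgxy⟩ := hdiff
  -- Trading copies of `y` for copies of `x` moves the sum `J * y` up in steps of `g = x - y`.
  obtain ⟨J, hJ⟩ := exists_nat_ge (A / g)
  refine ⟨J * y, g, J, hgs.1, hgs.2.le, (div_le_iff₀ hgs.1).1 hJ, fun j hj => ?_⟩
  have : (J : ℝ) * y + j * g = j • x + (J - j) • y := by
    rw [hgxy, nsmul_eq_mul, nsmul_eq_mul, Nat.cast_sub hj]; ring
  rw [this]
  exact add_mem (nsmul_mem hx _) (nsmul_mem hy _)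

/-- A function bounded above and below has a filter along which it converges to its upper limit. -/
theorem exists_filter_tendsto_limsup {Y : ℝ → ℝ} {B C : ℝ} (hB : ∀ t, B ≤ Y t)
    (hC : ∀ t, Y t ≤ C) :
    ∃ c, (∀ δ > 0, ∀ᶠ t in atTop, Y t ≤ c + δ) ∧
      ∃ l : Filter ℝ, l.NeBot ∧ l ≤ atTop ∧ Tendsto Y l (𝓝 c) := by
  have hbdd : IsBoundedUnder (· ≤ ·) atTop Y := isBoundedUnder_of ⟨C, hC⟩
  have hcob : IsCoboundedUnder (· ≤ ·) atTop Y :=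
    (isBoundedUnder_of ⟨B, hB⟩ : IsBoundedUnder (· ≥ ·) atTop Y).isCoboundedUnder_flip
  set c := limsup Y atTop
  have hup : ∀ δ > 0, ∀ᶠ t in atTop, Y t < c + δ := fun δ hδ =>
    eventually_lt_of_limsup_lt (lt_add_of_pos_right _ hδ) hbdd
  refine ⟨c, fun δ hδ => (hup δ hδ).mono fun _ => le_of_lt, atTop ⊓ comap Y (𝓝 c), ?_,
    inf_le_left, tendsto_comap.mono_left inf_le_right⟩
  rw [neBot_inf_comap_iff_map]
  have : MapClusterPt c atTop Y := by
    rw [(Metric.nhds_basis_ball (x := c)).mapClusterPt_iff_frequently]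
    intro δ hδ
    have h1 := frequently_lt_of_lt_limsup hcob (sub_lt_self c hδ)
    refine (h1.and_eventually (hup δ hδ)).mono fun t ht => ?_
    rw [Metric.mem_ball, Real.dist_eq, abs_lt]
    constructor <;> linarith [ht.1, ht.2]
  rw [inf_comm]
  exact this

namespace IsRenewalSolution

variable {ι : Type*} [Fintype ι] {p a : ι → ℝ} {γ : ℝ} {z Z : ℝ → ℝ}

theorem exists_step_bound (h : IsRenewalSolution p a γ z Z) : ∃ A, ∀ n, a n ≤ A := by
  refine ⟨∑ n, a n, fun n => ?_⟩
  exact Finset.single_le_sum (f := a) (fun m _ => (h.step_pos m).le) (Finset.mem_univ n)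

theorem mul_sum_le_window (h : IsRenewalSolution p a γ z Z) {A T b : ℝ} (hA : ∀ n, a n ≤ A)
    (hb : ∀ t ∈ Icc (T - A) T, b ≤ Z t) :
    (∑ n, p n * a n) * b ≤ ∑ n, p n * ∫ t in (T - a n)..T, Z t := by
  rw [Finset.sum_mul]
  refine Finset.sum_le_sum fun n _ => ?_
  rw [mul_assoc]
  refine mul_le_mul_of_nonneg_left ?_ (h.weight_pos n).le
  have ha := h.step_pos n
  have := intervalIntegral.integral_mono_on (a := T - a n) (b := T) (by linarith)
    (intervalIntegrable_const (c := b)) (h.intervalIntegrable _ _)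
    (fun t ht => hb t ⟨by linarith [ht.1, hA n], ht.2⟩)
  simpa using this

theorem window_le_mul_sum (h : IsRenewalSolution p a γ z Z) {A T b : ℝ} (hA : ∀ n, a n ≤ A)
    (hb : ∀ t ∈ Icc (T - A) T, Z t ≤ b) :
    ∑ n, p n * ∫ t in (T - a n)..T, Z t ≤ (∑ n, p n * a n) * b := by
  rw [Finset.sum_mul]
  refine Finset.sum_le_sum fun n _ => ?_
  rw [mul_assoc]
  refine mul_le_mul_of_nonneg_left ?_ (h.weight_pos n).le
  have ha := h.step_pos n
  have := intervalIntegral.integral_mono_on (a := T - a n) (b := T) (by linarith)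
    (h.intervalIntegrable _ _) (intervalIntegrable_const (c := b))
    (fun t ht => hb t ⟨by linarith [ht.1, hA n], ht.2⟩)
  simpa using this

/-- If `c` is the upper limit of `Z` and the steps generate a dense group, then `Z` is close to
`c` on long windows, and comparison with the integrated equation bounds `c` from above. -/
theorem limsup_le (h : IsRenewalSolution p a γ z Z)
    (hdense : Dense (AddSubgroup.closure (range a) : Set ℝ)) {c : ℝ}
    (hc : ∀ δ > 0, ∀ᶠ t in atTop, Z t ≤ c + δ) {l : Filter ℝ} [l.NeBot] (hl : l ≤ atTop)
    (hZl : Tendsto Z l (𝓝 c)) :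
    c ≤ (∫ t, z t) / ∑ n, p n * a n := by
  obtain ⟨A, hA⟩ := h.exists_step_bound
  have hμ := h.mean_pos
  have hγ := h.rate_pos
  have hstep : ∀ η > 0, (∑ n, p n * a n) * (Real.exp (-γ * η) * (c - η)) ≤ ∫ t, z t := by
    intro η hη
    obtain ⟨L, g, J, hg, hgη, hJ, hmem⟩ := exists_fine_progression hdense hη A
    have hwin : Tendsto (fun t => ∑ n, p n * ∫ s in (t - L - a n)..(t - L), Z s) l
        (𝓝 (∫ t, z t)) :=
      h.tendsto_sum_window.comp
        ((tendsto_atTop_add_const_right atTop (-L) tendsto_id).mono_left hl)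
    have hev : ∀ᶠ t in l, ∀ j ∈ Finset.range (J + 1), c - η ≤ Z (t - (L + j * g)) := by
      rw [Filter.eventually_all_finset]
      intro j hj
      have := tendsto_sub_of_mem_closure h.weight_pos h.weight_sum h.source_tendsto h.equation hc
        hl hZl (hmem j (Nat.lt_succ_iff.1 (Finset.mem_range.1 hj)))
      exact (this.eventually (lt_mem_nhds (sub_lt_self c hη))).mono fun _ => le_of_lt
    refine ge_of_tendsto hwin (hev.mono fun t ht => ?_)
    refine h.mul_sum_le_window hA fun s hs => ?_
    set j := ⌊(t - L - s) / g⌋₊ with hj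
    have hq : 0 ≤ (t - L - s) / g := div_nonneg (by linarith [hs.2]) hg.le
    have hj1 : (j : ℝ) * g ≤ t - L - s := (le_div_iff₀ hg).1 (Nat.floor_le hq)
    have hj2 : t - L - s < (j + 1) * g := (div_lt_iff₀ hg).1 (Nat.lt_floor_add_one _)
    have hjJ : j ≤ J := by
      rw [hj]
      refine Nat.floor_le_of_le ?_
      rw [div_le_iff₀ hg]; linarith [hs.1]
    have h1 := ht j (Finset.mem_range.2 (Nat.lt_succ_of_le hjJ))
    have h2 := h.growth s (t - (L + j * g) - s) (by linarith)
    rw [add_sub_cancel] at h2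
    have h3 : Real.exp (γ * (t - (L + j * g) - s)) ≤ Real.exp (γ * η) := by
      apply Real.exp_le_exp.2
      apply mul_le_mul_of_nonneg_left _ hγ.le
      linarith
    have h4 : c - η ≤ Real.exp (γ * η) * Z s :=
      h1.trans (h2.trans (mul_le_mul_of_nonneg_right h3 (h.nonneg s)))
    calc Real.exp (-γ * η) * (c - η) ≤ Real.exp (-γ * η) * (Real.exp (γ * η) * Z s) :=
          mul_le_mul_of_nonneg_left h4 (Real.exp_pos _).le
      _ = Z s := by rw [← mul_assoc, ← Real.exp_add]; simp
  rw [le_div_iff₀ hμ, mul_comm]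
  have hcont : Tendsto (fun η : ℝ => (∑ n, p n * a n) * (Real.exp (-γ * η) * (c - η))) (𝓝[>] 0)
      (𝓝 ((∑ n, p n * a n) * c)) := by
    have : Continuous (fun η : ℝ => (∑ n, p n * a n) * (Real.exp (-γ * η) * (c - η))) := by
      fun_prop
    have := this.tendsto 0
    simp only [mul_zero, Real.exp_zero, sub_zero, one_mul] at this
    exact this.mono_left nhdsWithin_le_nhds
  exact le_of_tendsto hcont (eventually_mem_nhdsWithin.mono fun η hη => hstep η hη)

/-- The counterpart of `limsup_le` for the lower limit `c`. -/
theorem le_liminf (h : IsRenewalSolution p a γ z Z)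
    (hdense : Dense (AddSubgroup.closure (range a) : Set ℝ)) {c : ℝ}
    (hc : ∀ δ > 0, ∀ᶠ t in atTop, c - δ ≤ Z t) {l : Filter ℝ} [l.NeBot] (hl : l ≤ atTop)
    (hZl : Tendsto Z l (𝓝 c)) :
    (∫ t, z t) / ∑ n, p n * a n ≤ c := by
  obtain ⟨A, hA⟩ := h.exists_step_bound
  have hμ := h.mean_pos
  have hγ := h.rate_pos
  have hstep : ∀ η > 0, ∫ t, z t ≤ (∑ n, p n * a n) * (Real.exp (γ * η) * (c + η)) := by
    intro η hη
    obtain ⟨L, g, J, hg, hgη, hJ, hmem⟩ := exists_fine_progression hdense hη A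
    have hwin : Tendsto (fun t => ∑ n, p n * ∫ s in (t - L - a n)..(t - L), Z s) l
        (𝓝 (∫ t, z t)) :=
      h.tendsto_sum_window.comp
        ((tendsto_atTop_add_const_right atTop (-L) tendsto_id).mono_left hl)
    have hev : ∀ᶠ t in l, ∀ j ∈ Finset.range (J + 1), Z (t - (L + j * g)) ≤ c + η := by
      rw [Filter.eventually_all_finset]
      intro j hj
      have := tendsto_sub_of_mem_closure (Y := fun t => -Z t) (y := fun t => -z t) (c := -c)
        (l := l) h.weight_pos h.weight_sum (by simpa using h.source_tendsto.neg)
        (fun t => by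
          rw [h.equation t]; simp only [mul_neg, Finset.sum_neg_distrib]; ring)
        (fun δ hδ => (hc δ hδ).mono fun t ht => by linarith)
        hl hZl.neg (hmem j (Nat.lt_succ_iff.1 (Finset.mem_range.1 hj)))
      have := this.neg
      simp only [neg_neg] at this
      exact (this.eventually (gt_mem_nhds (lt_add_of_pos_right c hη))).mono fun _ => le_of_lt
    refine le_of_tendsto hwin (hev.mono fun t ht => ?_)
    refine h.window_le_mul_sum hA fun s hs => ?_
    set j := ⌈(t - L - s) / g⌉₊ with hj
    have hq : 0 ≤ (t - L - s) / g := div_nonneg (by linarith [hs.2]) hg.le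
    have hj1 : t - L - s ≤ (j : ℝ) * g := (div_le_iff₀ hg).1 (Nat.le_ceil _)
    have hj2 : (j : ℝ) * g < t - L - s + g := by
      have := Nat.ceil_lt_add_one hq
      rw [← hj, ← sub_lt_iff_lt_add, lt_div_iff₀ hg] at this
      linarith
    have hjJ : j ≤ J := by
      rw [hj]
      refine Nat.ceil_le.2 ?_
      rw [div_le_iff₀ hg]; linarith [hs.1]
    have h1 := ht j (Finset.mem_range.2 (Nat.lt_succ_of_le hjJ))
    have h2 := h.growth (t - (L + j * g)) (s - (t - (L + j * g))) (by linarith)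
    rw [add_sub_cancel] at h2
    have h3 : Real.exp (γ * (s - (t - (L + j * g)))) ≤ Real.exp (γ * η) := by
      apply Real.exp_le_exp.2
      apply mul_le_mul_of_nonneg_left _ hγ.le
      linarith
    exact h2.trans ((mul_le_mul_of_nonneg_right h3 (h.nonneg _)).trans
      (mul_le_mul_of_nonneg_left h1 (Real.exp_pos _).le))
  rw [div_le_iff₀ hμ, mul_comm]
  have hcont : Tendsto (fun η : ℝ => (∑ n, p n * a n) * (Real.exp (γ * η) * (c + η))) (𝓝[>] 0)
      (𝓝 ((∑ n, p n * a n) * c)) := by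
    have : Continuous (fun η : ℝ => (∑ n, p n * a n) * (Real.exp (γ * η) * (c + η))) := by
      fun_prop
    have := this.tendsto 0
    simp only [mul_zero, Real.exp_zero, add_zero, one_mul] at this
    exact this.mono_left nhdsWithin_le_nhds
  exact ge_of_tendsto hcont (eventually_mem_nhdsWithin.mono fun η hη => hstep η hη)

/-- The renewal theorem for steps that generate a dense subgroup of `ℝ`. -/
theorem tendsto_of_dense (h : IsRenewalSolution p a γ z Z)
    (hdense : Dense (AddSubgroup.closure (range a) : Set ℝ)) :
    Tendsto Z atTop (𝓝 ((∫ t, z t) / ∑ n, p n * a n)) := by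
  obtain ⟨C, hC⟩ := h.bounded
  obtain ⟨c, hc, l, _, hl, hZl⟩ := exists_filter_tendsto_limsup h.nonneg hC
  obtain ⟨c', hc', l', _, hl', hZl'⟩ := exists_filter_tendsto_limsup
    (Y := fun t => -Z t) (B := -C) (C := 0) (fun t => neg_le_neg (hC t))
    (fun t => neg_nonpos.2 (h.nonneg t))
  have h1 := h.limsup_le hdense hc hl hZl
  have h2 := h.le_liminf hdense (c := -c')
    (fun δ hδ => (hc' δ hδ).mono fun t ht => by linarith) hl' (by simpa using hZl'.neg)
  rw [Metric.tendsto_nhds]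
  intro δ hδ
  filter_upwards [hc (δ / 2) (by positivity), hc' (δ / 2) (by positivity)] with t ht ht'
  rw [Real.dist_eq, abs_lt]
  constructor <;> linarith

/-- If all steps are multiples of `h₀` and `Z` converges, then along every arithmetic progression
of difference `h₀` the partial sums of the source converge; the boundary term is a finite sum of
earlier values of `Z`. -/
theorem tendsto_sum_source_of_tendsto (h : IsRenewalSolution p a γ z Z) {h₀ : ℝ} {m : ι → ℕ}
    (hm : ∀ n, a n = m n * h₀) (h₀pos : 0 < h₀) {c : ℝ} (hc : Tendsto Z atTop (𝓝 c)) (t : ℝ) :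
    Tendsto (fun K : ℕ => ∑ k ∈ Finset.range K, z (t + (k + 1) * h₀)) atTop
      (𝓝 ((∑ n, p n * m n) * c - ∑ n, p n * ∑ j ∈ Finset.range (m n), Z (t - j * h₀))) := by
  set q : ℕ → ℝ := fun K => ∑ n, p n * ∑ j ∈ Finset.range (m n), Z (t + (K : ℝ) * h₀ - j * h₀)
    with hq
  have hstep : ∀ K, q (K + 1) - q K = z (t + ((K : ℝ) + 1) * h₀) := by
    intro K
    have hn : ∀ n, ∑ j ∈ Finset.range (m n), Z (t + ((K + 1 : ℕ) : ℝ) * h₀ - j * h₀)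
        - ∑ j ∈ Finset.range (m n), Z (t + (K : ℝ) * h₀ - j * h₀)
        = Z (t + ((K : ℝ) + 1) * h₀) - Z (t + ((K : ℝ) + 1) * h₀ - a n) := by
      intro n
      have := Finset.sum_range_sub' (fun j : ℕ => Z (t + ((K : ℝ) + 1) * h₀ - j * h₀)) (m n)
      rw [← Finset.sum_sub_distrib]
      simp only [Nat.cast_zero, zero_mul, sub_zero, ← hm] at this
      rw [← this]
      refine Finset.sum_congr rfl fun j _ => ?_
      congr 2 <;> push_cast <;> ring
    simp only [hq, ← Finset.sum_sub_distrib, ← mul_sub, hn]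
    have := h.equation (t + ((K : ℝ) + 1) * h₀)
    simp only [mul_sub, Finset.sum_sub_distrib, ← Finset.sum_mul, h.weight_sum]
    linarith
  have hsum : ∀ K, ∑ k ∈ Finset.range K, z (t + (k + 1) * h₀) = q K - q 0 := by
    intro K
    rw [← Finset.sum_range_sub]
    exact Finset.sum_congr rfl fun k _ => (hstep k).symm
  have hqlim : Tendsto q atTop (𝓝 ((∑ n, p n * m n) * c)) := by
    rw [Finset.sum_mul]
    refine tendsto_finsetSum _ fun n _ => ?_
    rw [mul_assoc]
    refine Tendsto.const_mul _ ?_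
    have : (m n : ℝ) * c = ∑ j ∈ Finset.range (m n), c := by simp
    rw [this]
    refine tendsto_finsetSum _ fun j _ => hc.comp ?_
    refine tendsto_atTop_add_const_right _ (-((j : ℝ) * h₀)) (tendsto_atTop_add_const_left _ t ?_)
    exact tendsto_natCast_atTop_atTop.atTop_mul_const h₀pos
  simp only [hsum]
  have h0 : q 0 = ∑ n, p n * ∑ j ∈ Finset.range (m n), Z (t - j * h₀) := by simp [hq]
  rw [← h0]
  exact hqlim.sub_const _

end IsRenewalSolution

/-! ### Similarities and sets with frontier in a given set -/

namespace SelfSimilarSystem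

variable {d N : ℕ} (S : SelfSimilarSystem d N)

theorem exists_affine (n : Fin N) :
    ∃ (L : EuclideanSpace ℝ (Fin d) ≃ₗᵢ[ℝ] EuclideanSpace ℝ (Fin d))
      (c : EuclideanSpace ℝ (Fin d)), ∀ x, S.map n x = S.ratio n • L x + c := by
  have hr := S.ratio_pos n
  have hiso : Isometry fun x => (S.ratio n)⁻¹ • S.map n x := by
    refine Isometry.of_dist_eq fun x y => ?_
    rw [dist_smul₀, S.dist_map, Real.norm_of_nonneg (inv_pos.2 hr).le, inv_mul_cancel_left₀ hr.ne']
  set e := hiso.affineIsometryOfStrictConvexSpace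
  refine ⟨e.linearIsometry.toLinearIsometryEquiv rfl, S.map n 0, fun x => ?_⟩
  have h1 : e x = e.linearIsometry x + e 0 := by
    have := e.map_vadd 0 x
    simpa using this
  have h2 : e.linearIsometry x = (S.ratio n)⁻¹ • S.map n x - (S.ratio n)⁻¹ • S.map n 0 :=
    eq_sub_of_add_eq h1.symm
  rw [LinearIsometry.coe_toLinearIsometryEquiv, h2, ← smul_sub, smul_inv_smul₀ hr.ne']
  simp

/-- The similarities of the system as homeomorphisms of the whole space. -/
noncomputable def homeo (n : Fin N) : EuclideanSpace ℝ (Fin d) ≃ₜ EuclideanSpace ℝ (Fin d) :=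
  (S.exists_affine n).choose.toHomeomorph.trans
    ((Homeomorph.smulOfNeZero (S.ratio n) (S.ratio_pos n).ne').trans
      (Homeomorph.addRight (S.exists_affine n).choose_spec.choose))

@[simp]
theorem coe_homeo (n : Fin N) : ⇑(S.homeo n) = S.map n := by
  funext x
  exact ((S.exists_affine n).choose_spec.choose_spec x).symm

theorem injective_map (n : Fin N) : Function.Injective (S.map n) := by
  rw [← S.coe_homeo n]; exact (S.homeo n).injective

theorem isOpen_image {n : Fin N} {A : Set (EuclideanSpace ℝ (Fin d))} (hA : IsOpen A) :
    IsOpen (S.map n '' A) := by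
  rw [← S.coe_homeo n]; exact (S.homeo n).isOpenMap _ hA

theorem isClosed_image {n : Fin N} {A : Set (EuclideanSpace ℝ (Fin d))} (hA : IsClosed A) :
    IsClosed (S.map n '' A) := by
  rw [← S.coe_homeo n]; exact (S.homeo n).isClosedMap _ hA

theorem image_frontier (n : Fin N) (A : Set (EuclideanSpace ℝ (Fin d))) :
    S.map n '' frontier A = frontier (S.map n '' A) := by
  rw [← S.coe_homeo n]; exact (S.homeo n).image_frontier A

theorem image_closure (n : Fin N) (A : Set (EuclideanSpace ℝ (Fin d))) :
    S.map n '' closure A = closure (S.map n '' A) := by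
  rw [← S.coe_homeo n]; exact (S.homeo n).image_closure A

open scoped Pointwise in
theorem volume_image (n : Fin N) (A : Set (EuclideanSpace ℝ (Fin d))) :
    volume (S.map n '' A) = ENNReal.ofReal (S.ratio n ^ d) * volume A := by
  obtain ⟨L, c, hL⟩ := S.exists_affine n
  have h1 : S.map n '' A = (fun x => x + c) '' (S.ratio n • (L '' A)) := by
    rw [← image_smul, image_image, image_image]
    exact image_congr fun x _ => hL x
  have h2 : volume (L '' A) = volume A := by
    have := (L.symm.measurePreserving).measure_preimage_equiv (f := L.symm.toMeasurableEquiv) A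
    rw [← this]
    congr 1
    exact L.toEquiv.image_eq_preimage_symm A
  rw [h1, image_add_right, measure_preimage_add_right, Measure.addHaar_smul, h2,
    finrank_euclideanSpace_fin, abs_of_pos (pow_pos (S.ratio_pos n) d)]

theorem infEDist_image (n : Fin N) (x : EuclideanSpace ℝ (Fin d))
    (A : Set (EuclideanSpace ℝ (Fin d))) :
    Metric.infEDist (S.map n x) (S.map n '' A)
      = ENNReal.ofReal (S.ratio n) * Metric.infEDist x A := by
  have hr := S.ratio_pos n
  rw [Metric.infEDist, Metric.infEDist, iInf_image,
    ENNReal.mul_iInf_of_ne (by simpa using hr) ENNReal.ofReal_ne_top]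
  refine iInf_congr fun y => ?_
  rw [ENNReal.mul_iInf_of_ne (by simpa using hr) ENNReal.ofReal_ne_top]
  refine iInf_congr fun _ => ?_
  rw [edist_dist, edist_dist, S.dist_map, ENNReal.ofReal_mul hr.le]

theorem image_cthickening (n : Fin N) (ε : ℝ) (A : Set (EuclideanSpace ℝ (Fin d))) :
    S.map n '' Metric.cthickening (ε / S.ratio n) A
      = Metric.cthickening ε (S.map n '' A) := by
  have hr := S.ratio_pos n
  ext y
  obtain ⟨x, rfl⟩ : ∃ x, S.map n x = y := by
    rw [← S.coe_homeo n]; exact (S.homeo n).surjective y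
  rw [(S.injective_map n).mem_set_image, Metric.mem_cthickening_iff, Metric.mem_cthickening_iff,
    S.infEDist_image, ENNReal.ofReal_div_of_pos hr, ENNReal.le_div_iff_mul_le
      (Or.inl (by simpa using hr)) (Or.inl ENNReal.ofReal_ne_top), mul_comm]

theorem exists_ne_index {d N : ℕ} (S : SelfSimilarSystem d N) : ∃ n m : Fin N, n ≠ m := by
  have := S.two_le
  exact ⟨⟨0, by omega⟩, ⟨1, by omega⟩, by simp⟩

end SelfSimilarSystem

theorem IsPreconnected.subset_of_disjoint_frontier {X : Type*} [TopologicalSpace X] {s A : Set X}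
    (hs : IsPreconnected s) (hd : Disjoint s (frontier A)) (hne : (s ∩ A).Nonempty) : s ⊆ A := by
  have hcover : s ⊆ interior A ∪ (closure A)ᶜ := by
    intro x hx
    by_contra hcon
    rw [mem_union, not_or, notMem_compl_iff] at hcon
    exact disjoint_left.1 hd hx ⟨hcon.2, hcon.1⟩
  rcases hs.subset_or_subset isOpen_interior isClosed_closure.isOpen_compl
    (disjoint_compl_right.mono_left interior_subset_closure) hcover with h | h
  · exact h.trans interior_subset
  · obtain ⟨x, hx, hxA⟩ := hne
    exact absurd (subset_closure hxA) (h hx)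

/-- A path leaving `A` crosses the frontier. So from a point of `A`, a set `F` containing the
frontier is at least as close as any set `B` that meets `A` only inside `F`. -/
theorem infEDist_le_of_frontier_subset {E : Type*} [NormedAddCommGroup E] [NormedSpace ℝ E]
    {A B F : Set E} (hA : frontier A ⊆ F) (hB : B ∩ A ⊆ F) {x : E} (hx : x ∈ A) :
    Metric.infEDist x F ≤ Metric.infEDist x B := by
  refine Metric.le_infEDist.2 fun y hy => ?_
  by_cases hyA : y ∈ A
  · exact Metric.infEDist_le_edist_of_mem (hB ⟨hy, hyA⟩)
  have hnd : ¬ Disjoint (segment ℝ x y) (frontier A) := fun hd =>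
    hyA ((convex_segment x y).isPreconnected.subset_of_disjoint_frontier hd
      ⟨x, left_mem_segment ℝ x y, hx⟩ (right_mem_segment ℝ x y))
  obtain ⟨w, hw, hwA⟩ := not_disjoint_iff.1 hnd
  refine (Metric.infEDist_le_edist_of_mem (hA hwA)).trans ?_
  rw [edist_dist, edist_dist]
  refine ENNReal.ofReal_le_ofReal ?_
  rw [dist_comm, dist_comm x y]
  exact (Metric.mem_closedBall.1 (segment_subset_closedBall_left x y hw)).trans_eq (dist_comm _ _)

/-- An unbounded set with bounded frontier contains large balls all along some ray. -/
theorem exists_ray_ball_subset {E : Type*} [NormedAddCommGroup E] [NormedSpace ℝ E] {A : Set E}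
    {R : ℝ} (hR : 0 ≤ R) (hfr : frontier A ⊆ Metric.closedBall 0 R)
    (hA : ¬ Bornology.IsBounded A) :
    ∃ u : E, ‖u‖ = 1 ∧ ∀ t, R < t → Metric.ball (t • u) (t - R) ⊆ A := by
  obtain ⟨x, hxA, hxR⟩ : ∃ x ∈ A, R < ‖x‖ := by
    by_contra! hcon
    exact hA ((Metric.isBounded_closedBall (x := (0 : E)) (r := R)).subset fun y hy => by
      simpa using hcon y hy)
  have hx0 : 0 < ‖x‖ := hR.trans_lt hxR
  have hu : ‖‖x‖⁻¹ • x‖ = 1 := by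
    rw [norm_smul, norm_inv, norm_norm, inv_mul_cancel₀ hx0.ne']
  refine ⟨‖x‖⁻¹ • x, hu, fun t ht => ?_⟩
  set u := ‖x‖⁻¹ • x with hudef
  have hxu : x = ‖x‖ • u := by rw [hudef, smul_inv_smul₀ hx0.ne']
  set s := max t ‖x‖ with hs
  have hts : t ≤ s := le_max_left _ _
  have hxs : ‖x‖ ≤ s := le_max_right _ _
  have hdist : ∀ a b : ℝ, a ≤ b → dist (a • u) (b • u) = b - a := by
    intro a b hab
    rw [dist_eq_norm, ← sub_smul, norm_smul, hu, mul_one, Real.norm_eq_abs, abs_sub_comm,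
      abs_of_nonneg (sub_nonneg.2 hab)]
  have hbig : Metric.ball (s • u) (s - R) ⊆ A := by
    refine (convex_ball _ _).isPreconnected.subset_of_disjoint_frontier ?_ ⟨x, ?_, hxA⟩
    · refine disjoint_left.2 fun y hy hyf => ?_
      have h1 : ‖y‖ ≤ R := by simpa using hfr hyf
      have h2 : ‖s • u‖ = s := by
        rw [norm_smul, hu, mul_one, Real.norm_of_nonneg (hx0.le.trans hxs)]
      have h3 : ‖s • u‖ - ‖y‖ ≤ dist y (s • u) := by
        rw [dist_comm, dist_eq_norm]; exact norm_sub_norm_le _ _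
      have := Metric.mem_ball.1 hy
      linarith
    · rw [Metric.mem_ball]
      nth_rewrite 1 [hxu]
      rw [hdist _ _ hxs]
      linarith
  refine (Metric.ball_subset_ball' ?_).trans hbig
  rw [hdist _ _ hts]
  linarith

/-- Pairwise disjoint unbounded sets with bounded frontiers point in opposite directions, so there
are at most two of them. -/
theorem isBounded_of_disjoint_of_frontier {E : Type*} [NormedAddCommGroup E]
    [InnerProductSpace ℝ E] {A B C F : Set E} (hF : Bornology.IsBounded F) (hA : frontier A ⊆ F)
    (hB : frontier B ⊆ F) (hC : frontier C ⊆ F) (hAB : Disjoint A B) (hBC : Disjoint B C)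
    (hCA : Disjoint C A) :
    Bornology.IsBounded A ∨ Bornology.IsBounded B ∨ Bornology.IsBounded C := by
  by_contra! hcon
  obtain ⟨R₀, hR₀⟩ := (Metric.isBounded_iff_subset_closedBall (0 : E)).1 hF
  set R := max R₀ 1
  have hR : (1 : ℝ) ≤ R := le_max_right _ _
  have hFR : F ⊆ Metric.closedBall 0 R :=
    hR₀.trans (Metric.closedBall_subset_closedBall (le_max_left _ _))
  obtain ⟨u, hu, hu'⟩ := exists_ray_ball_subset (by linarith) (hA.trans hFR) hcon.1
  obtain ⟨v, hv, hv'⟩ := exists_ray_ball_subset (by linarith) (hB.trans hFR) hcon.2.1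
  obtain ⟨w, hw, hw'⟩ := exists_ray_ball_subset (by linarith) (hC.trans hFR) hcon.2.2
  -- At height `t = 10 R` the directions are at distance at least `9 / 5 > √3`.
  have hfar : ∀ {A B : Set E} {u v : E}, Disjoint A B →
      Metric.ball ((10 * R) • u) (10 * R - R) ⊆ A → Metric.ball ((10 * R) • v) (10 * R - R) ⊆ B →
      9 / 5 ≤ ‖u - v‖ := by
    intro A B u v hd hA hB
    by_contra! hlt
    have hdist : dist ((10 * R) • u) ((10 * R) • v) < 2 * (9 * R) := by
      rw [dist_eq_norm, ← smul_sub, norm_smul, Real.norm_of_nonneg (by linarith)]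
      nlinarith
    have hmem : midpoint ℝ ((10 * R) • u) ((10 * R) • v) ∈ A ∩ B := by
      refine ⟨hA ?_, hB ?_⟩
      all_goals
        first | rw [Metric.mem_ball, dist_midpoint_left] | rw [Metric.mem_ball, dist_midpoint_right]
        norm_num
        linarith
    exact Set.disjoint_left.1 hd hmem.1 hmem.2
  have huv := hfar hAB (hu' _ (by linarith)) (hv' _ (by linarith))
  have hvw := hfar hBC (hv' _ (by linarith)) (hw' _ (by linarith))
  have hwu := hfar hCA (hw' _ (by linarith)) (hu' _ (by linarith))
  have e1 := norm_sub_sq_real u v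
  have e2 := norm_sub_sq_real v w
  have e3 := norm_sub_sq_real w u
  have e4 := norm_add_sq_real (u + v) w
  have e5 := norm_add_sq_real u v
  have e6 : inner ℝ (u + v) w = inner ℝ w u + inner ℝ v w := by
    rw [inner_add_left, real_inner_comm u w]
  rw [hu, hv] at e1 e5
  rw [hv, hw] at e2
  rw [hw, hu] at e3
  rw [hw, e6, e5] at e4
  have := sq_nonneg ‖u + v + w‖
  nlinarith

/-! ### Geometry of tilings with one generator -/

namespace SelfSimilarSystem

/-- The geometric situation of a tiling with one generator: `F` is the attractor of `S`, and `O` is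
a feasible open set with frontier in `F` whose only generator is `G`. -/
structure IsMonogenic {d N : ℕ} (S : SelfSimilarSystem d N)
    (F O G : Set (EuclideanSpace ℝ (Fin d))) : Prop where
  attractor : S.IsAttractor F
  feasible : S.IsFeasible O
  frontier_subset : frontier O ⊆ F
  generators_eq : S.generators O = {G}

namespace IsMonogenic

variable {d N : ℕ} {S : SelfSimilarSystem d N} {F O G : Set (EuclideanSpace ℝ (Fin d))}

theorem isOpen (h : S.IsMonogenic F O G) : IsOpen O := h.feasible.2.1

theorem image_subset (h : S.IsMonogenic F O G) (n : Fin N) : S.map n '' O ⊆ O :=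
  h.feasible.2.2.1 n

theorem image_attractor_subset (h : S.IsMonogenic F O G) (n : Fin N) : S.map n '' F ⊆ F := by
  conv_rhs => rw [h.attractor.2.2]
  exact subset_iUnion (fun n => S.map n '' F) n

theorem frontier_image_subset (h : S.IsMonogenic F O G) {A : Set (EuclideanSpace ℝ (Fin d))}
    (hA : frontier A ⊆ F) (n : Fin N) : frontier (S.map n '' A) ⊆ F := by
  rw [← S.image_frontier]
  exact (image_mono hA).trans (h.image_attractor_subset n)

/-- If `O` were unbounded, then so would be three of its disjoint copies of level at most `2`. -/
theorem isBounded (h : S.IsMonogenic F O G) : Bornology.IsBounded O := by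
  obtain ⟨i, j, hij⟩ := S.exists_ne_index
  have hdisj := h.feasible.2.2.2
  have hback : ∀ n {A : Set (EuclideanSpace ℝ (Fin d))}, Bornology.IsBounded (S.map n '' A) →
      Bornology.IsBounded A := by
    intro n A hA
    obtain ⟨C, hC⟩ := Metric.isBounded_iff.1 hA
    refine Metric.isBounded_iff.2 ⟨C / S.ratio n, fun x hx y hy => ?_⟩
    rw [le_div_iff₀ (S.ratio_pos n), mul_comm, ← S.dist_map]
    exact hC (mem_image_of_mem _ hx) (mem_image_of_mem _ hy)
  have hfr := fun n => h.frontier_image_subset h.frontier_subset n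
  have hin : S.map j '' (S.map i '' O) ⊆ S.map j '' O := image_mono (h.image_subset i)
  have hin' : S.map j '' (S.map j '' O) ⊆ S.map j '' O := image_mono (h.image_subset j)
  rcases isBounded_of_disjoint_of_frontier h.attractor.2.1.isBounded (hfr i)
    (h.frontier_image_subset (hfr i) j) (h.frontier_image_subset (hfr j) j)
    ((hdisj i j hij).mono_right hin)
    (disjoint_image_of_injective (S.injective_map j) (hdisj i j hij))
    ((hdisj j i hij.symm).mono_left hin') with hb | hb | hb
  · exact hback _ hb
  · exact hback _ (hback _ hb)
  · exact hback _ (hback _ hb)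

theorem image_closure_subset (h : S.IsMonogenic F O G) (n : Fin N) :
    S.map n '' closure O ⊆ closure O := by
  rw [S.image_closure]; exact closure_mono (h.image_subset n)

/-- The point of `F` farthest from `closure O` is the image of a point of `F`, which forces its
distance to be zero. -/
theorem attractor_subset_closure (h : S.IsMonogenic F O G) : F ⊆ closure O := by
  have hne : (closure O).Nonempty := h.feasible.1.closure
  obtain ⟨x, hxF, hx⟩ := h.attractor.2.1.exists_isMaxOn h.attractor.1
    (Metric.continuous_infEDist (s := closure O)).continuousOn
  have hle : Metric.infEDist x (closure O) = 0 := by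
    obtain ⟨n, y, hy, hyx⟩ : ∃ n, ∃ y ∈ F, S.map n y = x := by
      have := hxF
      rw [h.attractor.2.2] at this
      obtain ⟨n, y, hy, hyx⟩ := mem_iUnion.1 this
      exact ⟨n, y, hy, hyx⟩
    have h1 : Metric.infEDist x (closure O)
        ≤ ENNReal.ofReal (S.ratio n) * Metric.infEDist x (closure O) := by
      calc Metric.infEDist x (closure O)
          ≤ Metric.infEDist x (S.map n '' closure O) :=
            Metric.infEDist_anti (h.image_closure_subset n)
        _ = ENNReal.ofReal (S.ratio n) * Metric.infEDist y (closure O) := by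
            rw [← hyx, S.infEDist_image]
        _ ≤ _ := mul_le_mul_right (hx hy) _
    by_contra hne0
    have h2 : ENNReal.ofReal (S.ratio n) < 1 := by
      rw [← ENNReal.ofReal_one]
      exact (ENNReal.ofReal_lt_ofReal_iff one_pos).2 (S.ratio_lt_one n)
    have h3 := ENNReal.mul_lt_mul_left hne0 (Metric.infEDist_ne_top hne (x := x)) h2
    rw [one_mul] at h3
    exact absurd h1 (not_le.2 h3)
  intro y hy
  rw [Metric.mem_iff_infEDist_zero_of_closed isClosed_closure]
  exact le_antisymm ((hx hy).trans hle.le) zero_le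

theorem isClosed_setMap_closure (S : SelfSimilarSystem d N)
    (O : Set (EuclideanSpace ℝ (Fin d))) : IsClosed (S.setMap (closure O)) :=
  isClosed_iUnion_of_finite fun _ => S.isClosed_image isClosed_closure

theorem generator_eq (h : S.IsMonogenic F O G) : G = O \ S.setMap (closure O) := by
  have hG : G ∈ S.generators O := by rw [h.generators_eq]; rfl
  refine Subset.antisymm ?_ fun x hx => ?_
  · obtain ⟨x, _, rfl⟩ := hG
    exact connectedComponentIn_subset _ _
  · have : connectedComponentIn (O \ S.setMap (closure O)) x ∈ S.generators O := ⟨x, hx, rfl⟩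
    rw [h.generators_eq] at this
    rw [← mem_singleton_iff.1 this]
    exact mem_connectedComponentIn hx

theorem generator_nonempty (h : S.IsMonogenic F O G) : G.Nonempty := by
  have hG : G ∈ S.generators O := by rw [h.generators_eq]; rfl
  obtain ⟨x, hx, rfl⟩ := hG
  exact ⟨x, mem_connectedComponentIn hx⟩

theorem isOpen_generator (h : S.IsMonogenic F O G) : IsOpen G := by
  rw [h.generator_eq]
  exact h.isOpen.sdiff (isClosed_setMap_closure S O)

theorem generator_subset (h : S.IsMonogenic F O G) : G ⊆ O := by
  rw [h.generator_eq]; exact sdiff_subset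

theorem frontier_generator_subset (h : S.IsMonogenic F O G) : frontier G ⊆ F := by
  have h1 : frontier G ⊆ frontier O ∪ frontier (S.setMap (closure O)) := by
    rw [h.generator_eq, sdiff_eq, ← frontier_compl (S.setMap (closure O))]
    refine (frontier_inter_subset _ _).trans ?_
    exact union_subset_union inter_subset_left inter_subset_right
  refine h1.trans (union_subset h.frontier_subset fun x hx => ?_)
  rw [(isClosed_setMap_closure S O).frontier_eq] at hx
  obtain ⟨n, hn⟩ := mem_iUnion.1 hx.1
  refine h.frontier_image_subset (frontier_closure_subset.trans h.frontier_subset) n ?_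
  rw [(S.isClosed_image isClosed_closure).frontier_eq]
  exact ⟨hn, fun hi => hx.2
    (interior_mono (subset_iUnion (fun n => S.map n '' closure O) n) hi)⟩

theorem disjoint_generator_image (h : S.IsMonogenic F O G) (n : Fin N) :
    Disjoint G (S.map n '' O) := by
  rw [h.generator_eq]
  refine disjoint_sdiff_left.mono_right ?_
  exact (image_mono subset_closure).trans (subset_iUnion (fun n => S.map n '' closure O) n)

theorem disjoint_generator_attractor (h : S.IsMonogenic F O G) : Disjoint G F := by
  rw [h.generator_eq]
  refine disjoint_sdiff_left.mono_right ?_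
  conv_lhs => rw [h.attractor.2.2]
  exact iUnion_mono fun n => image_mono h.attractor_subset_closure

theorem attractor_inter_image_subset (h : S.IsMonogenic F O G) (n : Fin N) :
    F ∩ S.map n '' O ⊆ S.map n '' F := by
  rintro x ⟨hxF, hxO⟩
  rw [h.attractor.2.2] at hxF
  obtain ⟨m, hm⟩ := mem_iUnion.1 hxF
  by_cases hmn : m = n
  · exact hmn ▸ hm
  · have h1 : x ∈ closure (S.map m '' O) := by
      rw [← S.image_closure]
      exact image_mono h.attractor_subset_closure hm
    exact absurd hxO (disjoint_left.1
      ((h.feasible.2.2.2 m n hmn).closure_left (S.isOpen_image h.isOpen)) h1)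

theorem sUnion_tiling_eq_iUnion (h : S.IsMonogenic F O G) :
    ⋃₀ S.tiling O = ⋃ w, S.wordMap w '' G := by
  ext x
  simp only [tiling, h.generators_eq, mem_singleton_iff, mem_sUnion, mem_ofPred_eq, mem_iUnion]
  constructor
  · rintro ⟨_, ⟨w, _, rfl, rfl⟩, hx⟩
    exact ⟨w, hx⟩
  · rintro ⟨w, hx⟩
    exact ⟨_, ⟨w, _, rfl, rfl⟩, hx⟩

/-- The union of the tiles solves the self-similarity equation with inhomogeneity `G`. -/
theorem sUnion_tiling_eq (h : S.IsMonogenic F O G) :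
    ⋃₀ S.tiling O = G ∪ ⋃ n, S.map n '' ⋃₀ S.tiling O := by
  rw [h.sUnion_tiling_eq_iUnion]
  ext x
  simp only [mem_union, mem_iUnion, image_iUnion]
  constructor
  · rintro ⟨w, hw⟩
    cases w with
    | nil => left; simpa [wordMap] using hw
    | cons n w =>
      right
      exact ⟨n, w, by rwa [wordMap, image_comp] at hw⟩
  · rintro (hx | ⟨n, w, hx⟩)
    · exact ⟨[], by simpa [wordMap] using hx⟩
    · exact ⟨n :: w, by rwa [wordMap, image_comp]⟩

theorem generator_subset_sUnion (h : S.IsMonogenic F O G) : G ⊆ ⋃₀ S.tiling O := by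
  rw [h.sUnion_tiling_eq]; exact subset_union_left

/-- Induction over the tiles: a property of sets that holds for `G` and passes from subsets of `O` to
their images under `S` holds for all tiles. -/
theorem sUnion_tiling_induction (h : S.IsMonogenic F O G)
    {P : Set (EuclideanSpace ℝ (Fin d)) → Prop} (hG : P G)
    (hstep : ∀ n A, A ⊆ O → P A → P (S.map n '' A)) {x : EuclideanSpace ℝ (Fin d)}
    (hx : x ∈ ⋃₀ S.tiling O) : ∃ A, x ∈ A ∧ A ⊆ O ∧ A ⊆ ⋃₀ S.tiling O ∧ IsOpen A ∧ P A := by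
  have key : ∀ w, S.wordMap w '' G ⊆ O ∧ IsOpen (S.wordMap w '' G) ∧ P (S.wordMap w '' G) := by
    intro w
    induction w with
    | nil =>
      rw [wordMap, image_id]
      exact ⟨h.generator_subset, h.isOpen_generator, hG⟩
    | cons n w ih =>
      rw [wordMap, image_comp]
      exact ⟨(image_mono ih.1).trans (h.image_subset n), S.isOpen_image ih.2.1,
        hstep n _ ih.1 ih.2.2⟩
  have hx' := hx
  rw [h.sUnion_tiling_eq_iUnion] at hx' ⊢
  obtain ⟨w, hw⟩ := mem_iUnion.1 hx'
  exact ⟨_, hw, (key w).1, subset_iUnion (fun w => S.wordMap w '' G) w, (key w).2.1, (key w).2.2⟩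

theorem sUnion_tiling_subset (h : S.IsMonogenic F O G) : ⋃₀ S.tiling O ⊆ O := by
  intro x hx
  obtain ⟨A, hxA, hAO, -⟩ := h.sUnion_tiling_induction (P := fun _ => True) trivial
    (fun _ _ _ _ => trivial) hx
  exact hAO hxA

theorem isOpen_sUnion_tiling (h : S.IsMonogenic F O G) : IsOpen (⋃₀ S.tiling O) := by
  refine isOpen_iff_mem_nhds.2 fun x hx => ?_
  obtain ⟨A, hxA, -, hAT, hA, -⟩ := h.sUnion_tiling_induction (P := fun _ => True) trivial
    (fun _ _ _ _ => trivial) hx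
  exact mem_of_superset (hA.mem_nhds hxA) hAT

theorem disjoint_sUnion_tiling_attractor (h : S.IsMonogenic F O G) :
    Disjoint (⋃₀ S.tiling O) F := by
  refine Set.disjoint_left.2 fun x hx hxF => ?_
  obtain ⟨A, hxA, -, -, -, hA⟩ := h.sUnion_tiling_induction (P := fun A => Disjoint A F)
    h.disjoint_generator_attractor (fun n A hAO hA => by
      refine Set.disjoint_left.2 fun y hy hyF => ?_
      have h1 := h.attractor_inter_image_subset n ⟨hyF, image_mono hAO hy⟩
      exact Set.disjoint_left.1 (disjoint_image_of_injective (S.injective_map n) hA) hy h1) hx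
  exact Set.disjoint_left.1 hA hxA hxF

theorem infEDist_compl_sUnion_tiling (h : S.IsMonogenic F O G) {x : EuclideanSpace ℝ (Fin d)}
    (hx : x ∈ ⋃₀ S.tiling O) :
    Metric.infEDist x (⋃₀ S.tiling O)ᶜ = Metric.infEDist x F := by
  refine le_antisymm
    (Metric.infEDist_anti h.disjoint_sUnion_tiling_attractor.subset_compl_left) ?_
  obtain ⟨A, hxA, -, hAT, -, hA⟩ := h.sUnion_tiling_induction (P := fun A => frontier A ⊆ F)
    h.frontier_generator_subset (fun n A _ hA => h.frontier_image_subset hA n) hx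
  exact infEDist_le_of_frontier_subset hA (fun y hy => absurd (hAT hy.2) hy.1) hxA

theorem infEDist_compl_generator (h : S.IsMonogenic F O G) {x : EuclideanSpace ℝ (Fin d)}
    (hx : x ∈ G) : Metric.infEDist x Gᶜ = Metric.infEDist x F :=
  le_antisymm (Metric.infEDist_anti h.disjoint_generator_attractor.subset_compl_left)
    (infEDist_le_of_frontier_subset h.frontier_generator_subset
      (fun _ hy => absurd hy.2 hy.1) hx)

theorem innerParallelVolume_tiling (h : S.IsMonogenic F O G) (ε : ℝ) :
    innerParallelVolume (⋃₀ S.tiling O) ε = volume (⋃₀ S.tiling O ∩ Metric.cthickening ε F) := by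
  rw [innerParallelVolume]
  congr 1
  ext x
  refine and_congr_right fun hx => ?_
  rw [Metric.mem_cthickening_iff, Metric.mem_cthickening_iff, h.infEDist_compl_sUnion_tiling hx]

theorem innerParallelVolume_generator (h : S.IsMonogenic F O G) (ε : ℝ) :
    innerParallelVolume G ε = volume (G ∩ Metric.cthickening ε F) := by
  rw [innerParallelVolume]
  congr 1
  ext x
  refine and_congr_right fun hx => ?_
  rw [Metric.mem_cthickening_iff, Metric.mem_cthickening_iff, h.infEDist_compl_generator hx]

/-- Inside `S.map n '' O`, the parallel sets of `F` and of its copy `S.map n '' F` agree. -/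
theorem image_inter_cthickening (h : S.IsMonogenic F O G) (n : Fin N)
    {A : Set (EuclideanSpace ℝ (Fin d))} (hA : A ⊆ O) (ε : ℝ) :
    S.map n '' A ∩ Metric.cthickening ε F
      = S.map n '' (A ∩ Metric.cthickening (ε / S.ratio n) F) := by
  rw [image_inter (S.injective_map n), S.image_cthickening]
  ext x
  refine and_congr_right fun hx => ?_
  rw [Metric.mem_cthickening_iff, Metric.mem_cthickening_iff]
  have : Metric.infEDist x F = Metric.infEDist x (S.map n '' F) := by
    refine le_antisymm (Metric.infEDist_anti (h.image_attractor_subset n)) ?_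
    refine infEDist_le_of_frontier_subset (A := S.map n '' O) ?_
      (h.attractor_inter_image_subset n) (image_mono hA hx)
    rw [← S.image_frontier]
    exact image_mono h.frontier_subset
  rw [this]

theorem volume_tiling_inter (h : S.IsMonogenic F O G) (ε : ℝ) :
    volume (⋃₀ S.tiling O ∩ Metric.cthickening ε F)
      = volume (G ∩ Metric.cthickening ε F) + ∑ n, ENNReal.ofReal (S.ratio n ^ d) *
          volume (⋃₀ S.tiling O ∩ Metric.cthickening (ε / S.ratio n) F) := by
  have hcl : MeasurableSet (Metric.cthickening ε F) := Metric.isClosed_cthickening.measurableSet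
  have hTim : ∀ n, S.map n '' ⋃₀ S.tiling O ⊆ S.map n '' O :=
    fun n => image_mono h.sUnion_tiling_subset
  have hmeas : ∀ n, MeasurableSet (S.map n '' (⋃₀ S.tiling O) ∩ Metric.cthickening ε F) :=
    fun n => (S.isOpen_image h.isOpen_sUnion_tiling).measurableSet.inter hcl
  conv_lhs => rw [h.sUnion_tiling_eq, union_inter_distrib_right, iUnion_inter]
  rw [measure_union, measure_iUnion, tsum_fintype]
  · congr 1
    refine Finset.sum_congr rfl fun n _ => ?_
    rw [h.image_inter_cthickening n h.sUnion_tiling_subset, S.volume_image]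
  · intro n m hnm
    exact (((h.feasible.2.2.2 n m hnm).mono (hTim n) (hTim m)).mono inter_subset_left
      inter_subset_left)
  · exact hmeas
  · rw [disjoint_iUnion_right]
    exact fun n => ((h.disjoint_generator_image n).mono_right (hTim n)).mono inter_subset_left
      inter_subset_left
  · exact MeasurableSet.iUnion hmeas

theorem volume_ne_top (h : S.IsMonogenic F O G) : volume O ≠ ∞ := h.isBounded.measure_lt_top.ne

theorem volume_generator_pos (h : S.IsMonogenic F O G) : 0 < volume G :=
  h.isOpen_generator.measure_pos _ h.generator_nonempty

theorem sum_ratio_pow_lt_one (h : S.IsMonogenic F O G) : ∑ n, S.ratio n ^ d < 1 := by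
  have hsub : G ∪ ⋃ n, S.map n '' O ⊆ O :=
    union_subset h.generator_subset (iUnion_subset h.image_subset)
  have hmeas : ∀ n, MeasurableSet (S.map n '' O) := fun n => (S.isOpen_image h.isOpen).measurableSet
  have h1 := measure_mono (μ := volume) hsub
  rw [measure_union (disjoint_iUnion_right.2 h.disjoint_generator_image) (MeasurableSet.iUnion hmeas),
    measure_iUnion (fun n m hnm => h.feasible.2.2.2 n m hnm) hmeas, tsum_fintype] at h1
  simp only [S.volume_image] at h1
  rw [← Finset.sum_mul, ← ENNReal.ofReal_sum_of_nonneg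
    fun n _ => (pow_pos (S.ratio_pos n) d).le] at h1
  by_contra! hcon
  have h2 : volume O ≤ ENNReal.ofReal (∑ n, S.ratio n ^ d) * volume O := by
    conv_lhs => rw [← one_mul (volume O)]
    gcongr
    exact ENNReal.one_le_ofReal.2 hcon
  have h3 : volume G + volume O ≤ 0 + volume O := by
    rw [zero_add]
    exact (add_le_add_right h2 _).trans h1
  have h4 := (ENNReal.add_le_add_iff_right h.volume_ne_top).1 h3
  exact absurd h.volume_generator_pos (not_lt.2 h4)

/-- Sets of finite volume that are, up to null sets, covered by their own images under `S`
are null. -/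
theorem volume_eq_zero_of_subset (h : S.IsMonogenic F O G) {A B : Set (EuclideanSpace ℝ (Fin d))}
    (hA : volume A ≠ ∞) (hB : volume B = 0) (hsub : A ⊆ B ∪ ⋃ n, S.map n '' A) :
    volume A = 0 := by
  have h1 : volume A ≤ ENNReal.ofReal (∑ n, S.ratio n ^ d) * volume A := by
    calc volume A ≤ volume B + ∑ n, volume (S.map n '' A) :=
          (measure_mono hsub).trans ((measure_union_le _ _).trans
            (add_le_add_right (measure_iUnion_fintype_le _ _) _))
      _ = ENNReal.ofReal (∑ n, S.ratio n ^ d) * volume A := by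
          simp only [hB, zero_add, S.volume_image]
          rw [← Finset.sum_mul, ← ENNReal.ofReal_sum_of_nonneg
            fun n _ => (pow_pos (S.ratio_pos n) d).le]
  by_contra hne
  have h2 : ENNReal.ofReal (∑ n, S.ratio n ^ d) < 1 := by
    rw [← ENNReal.ofReal_one]
    exact (ENNReal.ofReal_lt_ofReal_iff one_pos).2 h.sum_ratio_pow_lt_one
  have h3 := ENNReal.mul_lt_mul_left hne hA h2
  rw [one_mul] at h3
  exact absurd h1 (not_le.2 h3)

theorem volume_attractor (h : S.IsMonogenic F O G) : volume F = 0 := by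
  refine h.volume_eq_zero_of_subset (B := ∅) h.attractor.2.1.measure_lt_top.ne measure_empty ?_
  rw [empty_union]
  exact h.attractor.2.2.subset

theorem volume_closure_ne_top (h : S.IsMonogenic F O G) : volume (closure O) ≠ ∞ :=
  h.isBounded.closure.measure_lt_top.ne

/-- The tiles exhaust `closure O` up to a null set. -/
theorem volume_closure_diff (h : S.IsMonogenic F O G) :
    volume (closure O \ ⋃₀ S.tiling O) = 0 := by
  refine h.volume_eq_zero_of_subset (B := F)
    (measure_ne_top_of_subset sdiff_subset h.volume_closure_ne_top) h.volume_attractor ?_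
  rintro x ⟨hxK, hxT⟩
  rw [closure_eq_self_union_frontier] at hxK
  rcases hxK with hxO | hxf
  · by_cases hxG : x ∈ G
    · exact absurd (h.generator_subset_sUnion hxG) hxT
    · rw [h.generator_eq, Set.mem_sdiff, not_and, not_not] at hxG
      obtain ⟨n, y, hy, rfl⟩ := mem_iUnion.1 (hxG hxO)
      refine Or.inr (mem_iUnion.2 ⟨n, y, ⟨hy, fun hyT => hxT ?_⟩, rfl⟩)
      rw [h.sUnion_tiling_eq]
      exact Or.inr (mem_iUnion.2 ⟨n, mem_image_of_mem _ hyT⟩)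
  · exact Or.inl (h.frontier_subset hxf)

/-- The parallel set of `F` is made up of the inner parallel set of the tiling and the outer
parallel set of `closure O`. -/
theorem parallelVolume_eq (h : S.IsMonogenic F O G) (ε : ℝ) :
    parallelVolume F ε
      = innerParallelVolume (⋃₀ S.tiling O) ε + outerParallelVolume (closure O) ε := by
  rw [h.innerParallelVolume_tiling, parallelVolume, outerParallelVolume,
    ← measure_inter_add_sdiff (Metric.cthickening ε F) isClosed_closure.measurableSet]
  congr 1
  · refine le_antisymm ?_ (measure_mono fun x hx =>
      ⟨hx.2, subset_closure (h.sUnion_tiling_subset hx.1)⟩)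
    have hsub : Metric.cthickening ε F ∩ closure O
        ⊆ (⋃₀ S.tiling O ∩ Metric.cthickening ε F) ∪ (closure O \ ⋃₀ S.tiling O) := by
      rintro x ⟨hxF, hxK⟩
      by_cases hxT : x ∈ ⋃₀ S.tiling O
      · exact Or.inl ⟨hxT, hxF⟩
      · exact Or.inr ⟨hxK, hxT⟩
    refine (measure_mono hsub).trans ((measure_union_le _ _).trans ?_)
    rw [h.volume_closure_diff, add_zero]
  · rw [← measure_sdiff (Metric.self_subset_cthickening _) isClosed_closure.nullMeasurableSet
      h.volume_closure_ne_top]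
    congr 1
    ext x
    refine and_congr_left fun hx => ?_
    rw [Metric.mem_cthickening_iff, Metric.mem_cthickening_iff]
    have : Metric.infEDist x F = Metric.infEDist x (closure O) := by
      refine le_antisymm ?_ (Metric.infEDist_anti h.attractor_subset_closure)
      refine infEDist_le_of_frontier_subset (A := (closure O)ᶜ) ?_
        (fun y hy => absurd hy.1 hy.2) hx
      rw [frontier_compl]
      exact frontier_closure_subset.trans h.frontier_subset
    rw [this]

theorem bddAbove_inradius (h : S.IsMonogenic F O G) (hd : 0 < d) :
    BddAbove {ρ : ℝ | ∃ x, Metric.ball x ρ ⊆ G} := by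
  refine ⟨Metric.diam G, ?_⟩
  rintro ρ ⟨x, hx⟩
  have hb : Bornology.IsBounded G := h.isBounded.subset h.generator_subset
  refine le_of_forall_lt fun t ht => ?_
  by_contra! hcon
  have ht0 : 0 ≤ t := Metric.diam_nonneg.trans hcon
  obtain ⟨s, hts, hsρ⟩ := exists_between ht
  have hdist : dist (x + EuclideanSpace.single (⟨0, hd⟩ : Fin d) s) x = s := by
    rw [dist_eq_norm, add_sub_cancel_left, PiLp.norm_single,
      Real.norm_of_nonneg (ht0.trans hts.le)]
  have := Metric.dist_le_diam_of_mem hb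
    (hx (Metric.mem_ball.2 (hdist.trans_lt hsρ)))
    (hx (Metric.mem_ball_self ((ht0.trans_lt hts).trans hsρ)))
  rw [hdist] at this
  linarith

theorem inradius_pos (h : S.IsMonogenic F O G) (hd : 0 < d) : 0 < inradius G := by
  obtain ⟨x, hx⟩ := h.generator_nonempty
  obtain ⟨δ, hδ, hball⟩ := Metric.isOpen_iff.1 h.isOpen_generator x hx
  exact hδ.trans_le (le_csSup (h.bddAbove_inradius hd) ⟨x, hball⟩)

/-- No point of a tile is farther from `F` than the inradius of the generator. -/
theorem sUnion_tiling_subset_cthickening (h : S.IsMonogenic F O G) (hd : 0 < d) {ε : ℝ}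
    (hε : inradius G ≤ ε) : ⋃₀ S.tiling O ⊆ Metric.cthickening ε F := by
  have hG : ∀ y ∈ G, Metric.infEDist y F ≤ ENNReal.ofReal (inradius G) := by
    intro y hy
    rw [← h.infEDist_compl_generator hy]
    by_contra! hlt
    obtain ⟨ρ, hρ0, hρ1, hρ2⟩ := ENNReal.lt_iff_exists_real_btwn.1 hlt
    have hball : Metric.ball y ρ ⊆ G := by
      intro v hv
      by_contra hvG
      have h1 := Metric.infEDist_le_edist_of_mem (x := y) (mem_compl hvG)
      have h2 : edist y v ≤ ENNReal.ofReal ρ := by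
        rw [edist_dist, dist_comm]
        exact ENNReal.ofReal_le_ofReal (Metric.mem_ball.1 hv).le
      exact absurd (h1.trans h2) (not_le.2 hρ2)
    have h3 : ρ ≤ inradius G := le_csSup (h.bddAbove_inradius hd) ⟨y, hball⟩
    exact absurd (ENNReal.ofReal_le_ofReal h3) (not_le.2 hρ1)
  have hstep : ∀ n, ∀ A : Set (EuclideanSpace ℝ (Fin d)), A ⊆ O →
      (∀ y ∈ A, Metric.infEDist y F ≤ ENNReal.ofReal (inradius G)) →
      ∀ y ∈ S.map n '' A, Metric.infEDist y F ≤ ENNReal.ofReal (inradius G) := by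
    rintro n A - hA _ ⟨y, hy, rfl⟩
    calc Metric.infEDist (S.map n y) F ≤ Metric.infEDist (S.map n y) (S.map n '' F) :=
          Metric.infEDist_anti (h.image_attractor_subset n)
      _ = ENNReal.ofReal (S.ratio n) * Metric.infEDist y F := S.infEDist_image _ _ _
      _ ≤ 1 * ENNReal.ofReal (inradius G) := by
          gcongr
          · rw [← ENNReal.ofReal_one]
            exact ENNReal.ofReal_le_ofReal (S.ratio_lt_one n).le
          · exact hA y hy
      _ = _ := one_mul _
  intro x hx
  obtain ⟨A, hxA, -, -, -, hA⟩ := h.sUnion_tiling_induction hG hstep hx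
  exact Metric.mem_cthickening_iff.2 ((hA x hxA).trans (ENNReal.ofReal_le_ofReal hε))

end IsMonogenic

end SelfSimilarSystem

/-! ### Contents in logarithmic scale -/

/-- A function satisfying the renewal inequality from `t₁` on is bounded there by its bound on an
initial window longer than all steps. -/
theorem le_of_renewal_le {ι : Type*} [Fintype ι] [Nonempty ι] {p a : ι → ℝ} {Y : ℝ → ℝ}
    (hp : ∀ n, 0 < p n) (hsum : ∑ n, p n = 1) (ha : ∀ n, 0 < a n) {A t₁ C : ℝ}
    (hA : ∀ n, a n ≤ A) (hY : ∀ t, t₁ ≤ t → Y t ≤ ∑ n, p n * Y (t - a n))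
    (hC : ∀ t ∈ Icc (t₁ - A) t₁, Y t ≤ C) {t : ℝ} (ht : t₁ - A ≤ t) : Y t ≤ C := by
  obtain ⟨n₀, hn₀⟩ := Finite.exists_min a
  have key : ∀ k : ℕ, ∀ t, t₁ - A ≤ t → t ≤ t₁ + k * a n₀ → Y t ≤ C := by
    intro k
    induction k with
    | zero => intro t h1 h2; exact hC t ⟨h1, by simpa using h2⟩
    | succ k ih =>
      intro t h1 h2
      rcases le_total t t₁ with h3 | h3
      · exact hC t ⟨h1, h3⟩
      · calc Y t ≤ ∑ n, p n * Y (t - a n) := hY t h3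
          _ ≤ ∑ n, p n * C := by
              refine Finset.sum_le_sum fun n _ => mul_le_mul_of_nonneg_left ?_ (hp n).le
              refine ih _ (by linarith [hA n]) ?_
              push_cast at h2
              linarith [hn₀ n]
          _ = C := by rw [← Finset.sum_mul, hsum, one_mul]
  obtain ⟨k, hk⟩ := exists_nat_ge ((t - t₁) / a n₀)
  refine key k t ht ?_
  rw [div_le_iff₀ (ha n₀)] at hk
  linarith

/-- The volume function `V` in logarithmic scale, `t ↦ exp (γ t) * V (exp (-t))`. -/
noncomputable def logScale (γ : ℝ) (V : ℝ → ℝ≥0∞) (t : ℝ) : ℝ :=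
  Real.exp (γ * t) * (V (Real.exp (-t))).toReal

theorem logScale_nonneg (γ : ℝ) (V : ℝ → ℝ≥0∞) (t : ℝ) : 0 ≤ logScale γ V t :=
  mul_nonneg (Real.exp_pos _).le ENNReal.toReal_nonneg

theorem logScale_eq_exp_mul (γ γ' : ℝ) (V : ℝ → ℝ≥0∞) (t : ℝ) :
    logScale γ' V t = Real.exp ((γ' - γ) * t) * logScale γ V t := by
  rw [logScale, logScale, ← mul_assoc, ← Real.exp_add]
  ring_nf

theorem antitone_toReal_comp_exp_neg {V : ℝ → ℝ≥0∞} (hV : Monotone V) (hfin : ∀ ε, V ε ≠ ∞) :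
    Antitone fun t => (V (Real.exp (-t))).toReal := fun _ _ hst =>
  ENNReal.toReal_mono (hfin _) (hV (Real.exp_le_exp.2 (neg_le_neg hst)))

theorem intervalIntegrable_logScale {γ : ℝ} {V : ℝ → ℝ≥0∞} (hV : Monotone V)
    (hfin : ∀ ε, V ε ≠ ∞) (u v : ℝ) : IntervalIntegrable (logScale γ V) volume u v :=
  ((antitone_toReal_comp_exp_neg hV hfin).intervalIntegrable).continuousOn_mul
    (by fun_prop)

theorem logScale_add_le {γ : ℝ} {V : ℝ → ℝ≥0∞} (hV : Monotone V) (hfin : ∀ ε, V ε ≠ ∞) (t : ℝ)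
    {s : ℝ} (hs : 0 ≤ s) : logScale γ V (t + s) ≤ Real.exp (γ * s) * logScale γ V t := by
  rw [logScale, logScale, ← mul_assoc, ← Real.exp_add, mul_add, add_comm (γ * s)]
  exact mul_le_mul_of_nonneg_left
    (antitone_toReal_comp_exp_neg hV hfin (le_add_of_nonneg_right hs)) (Real.exp_pos _).le

/-- Rescaling the parallel radius by `r` is a shift by `-log r` in logarithmic scale. -/
theorem rpow_mul_logScale_sub {d : ℕ} {s r : ℝ} (hr : 0 < r) (V : ℝ → ℝ≥0∞) (t : ℝ) :
    r ^ s * logScale (d - s) V (t - -Real.log r)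
      = Real.exp ((d - s) * t) * (r ^ d * (V (Real.exp (-t) / r)).toReal) := by
  have h1 : Real.exp (-(t - -Real.log r)) = Real.exp (-t) / r := by
    rw [show -(t - -Real.log r) = -t - Real.log r by ring, Real.exp_sub, Real.exp_log hr]
  have h2 : r ^ s * Real.exp (((d : ℝ) - s) * (t - -Real.log r))
      = Real.exp ((d - s) * t) * r ^ d := by
    rw [Real.rpow_def_of_pos hr, ← Real.rpow_natCast r d, Real.rpow_def_of_pos hr,
      ← Real.exp_add, ← Real.exp_add]
    ring_nf
  rw [logScale, h1, ← mul_assoc, h2, mul_assoc]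

theorem hasContent_iff_tendsto_logScale {d : ℕ} {α : ℝ} {V : ℝ → ℝ≥0∞} (hfin : ∀ ε, V ε ≠ ∞)
    {c : ℝ≥0∞} :
    HasContent d α V c ↔
      Tendsto (fun t => ENNReal.ofReal (logScale (d - α) V t)) atTop (𝓝 c) := by
  rw [HasContent, ← Real.map_exp_atBot, ← map_neg_atTop, tendsto_map'_iff, tendsto_map'_iff]
  refine tendsto_congr fun t => ?_
  have h1 : (Real.exp (-t)) ^ ((d : ℝ) - α) = (Real.exp ((d - α) * t))⁻¹ := by
    rw [← Real.exp_mul, ← Real.exp_neg]; ring_nf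
  simp only [Function.comp_apply, logScale]
  rw [h1, ENNReal.ofReal_inv_of_pos (Real.exp_pos _), div_eq_mul_inv, inv_inv,
    ENNReal.ofReal_mul (Real.exp_pos _).le, ENNReal.ofReal_toReal (hfin _), mul_comm]

theorem HasContent.of_tendsto {d : ℕ} {α L : ℝ} {V : ℝ → ℝ≥0∞} (hfin : ∀ ε, V ε ≠ ∞)
    (h : Tendsto (logScale (d - α) V) atTop (𝓝 L)) : HasContent d α V (ENNReal.ofReal L) :=
  (hasContent_iff_tendsto_logScale hfin).2 (ENNReal.tendsto_ofReal h)

theorem HasContent.tendsto {d : ℕ} {α : ℝ} {V : ℝ → ℝ≥0∞} (hfin : ∀ ε, V ε ≠ ∞) {c : ℝ≥0∞}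
    (hc : c ≠ ∞) (h : HasContent d α V c) :
    Tendsto (logScale (d - α) V) atTop (𝓝 c.toReal) := by
  have := (ENNReal.tendsto_toReal hc).comp ((hasContent_iff_tendsto_logScale hfin).1 h)
  refine this.congr fun t => ?_
  simp [ENNReal.toReal_ofReal (logScale_nonneg _ _ _)]

/-- The substitution `ε = exp (-t)` turns the logarithmic average of a content into an ordinary
integral mean. -/
theorem HasAverageContent.of_tendsto {d : ℕ} {α L : ℝ} {V : ℝ → ℝ≥0∞} (hV : Monotone V)
    (hfin : ∀ ε, V ε ≠ ∞)
    (h : Tendsto (fun T => (∫ t in (0 : ℝ)..T, logScale (d - α) V t) / T) atTop (𝓝 L)) :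
    HasAverageContent d α V (ENNReal.ofReal L) := by
  have h1 := (ENNReal.tendsto_ofReal h).comp Real.tendsto_log_atTop
  refine h1.congr' ?_
  filter_upwards [eventually_gt_atTop 1] with b hb
  have hlog : 0 < Real.log b := Real.log_pos hb
  have himage : Icc (1 / b) 1 = (fun t : ℝ => Real.exp (-t)) '' Icc 0 (Real.log b) := by
    ext x
    constructor
    · rintro ⟨hx1, hx2⟩
      have hx0 : 0 < x := lt_of_lt_of_le (by positivity) hx1
      refine ⟨-Real.log x, ⟨neg_nonneg.2 (Real.log_nonpos hx0.le hx2), ?_⟩, ?_⟩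
      · have := Real.log_le_log (by positivity) hx1
        rw [one_div, Real.log_inv] at this
        linarith
      · simp only [neg_neg]
        exact Real.exp_log hx0
    · rintro ⟨t, ⟨ht1, ht2⟩, rfl⟩
      constructor
      · rw [one_div, ← Real.exp_log (by linarith : 0 < b), ← Real.exp_neg]
        exact Real.exp_le_exp.2 (neg_le_neg ht2)
      · exact Real.exp_le_one_iff.2 (neg_nonpos.2 ht1)
  have hderiv : ∀ t ∈ Icc 0 (Real.log b),
      HasDerivWithinAt (fun t : ℝ => Real.exp (-t)) (-Real.exp (-t)) (Icc 0 (Real.log b)) t := by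
    intro t _
    have := ((hasDerivAt_id t).fun_neg.exp).hasDerivWithinAt (s := Icc 0 (Real.log b))
    simpa using this
  have hinj : InjOn (fun t : ℝ => Real.exp (-t)) (Icc 0 (Real.log b)) := fun x _ y _ hxy =>
    neg_injective (Real.exp_injective hxy)
  rw [himage, lintegral_image_eq_lintegral_abs_deriv_mul measurableSet_Icc hderiv hinj]
  have hpt : ∀ t : ℝ, ENNReal.ofReal |-Real.exp (-t)| *
      (ENNReal.ofReal (Real.exp (-t) ^ (-((d : ℝ) - α))) * V (Real.exp (-t)) *
        ENNReal.ofReal (1 / Real.exp (-t))) = ENNReal.ofReal (logScale (d - α) V t) := by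
    intro t
    rw [logScale, abs_neg, abs_of_pos (Real.exp_pos _), ENNReal.ofReal_mul (Real.exp_pos _).le,
      ENNReal.ofReal_toReal (hfin _), ← Real.exp_mul,
      show -t * -((d : ℝ) - α) = ((d : ℝ) - α) * t by ring, mul_comm (ENNReal.ofReal _) (_ * _),
      mul_assoc, ← ENNReal.ofReal_mul (by positivity), one_div, inv_mul_cancel₀ (Real.exp_pos _).ne',
      ENNReal.ofReal_one, mul_one]
  have hint : IntegrableOn (logScale (d - α) V) (Ioc 0 (Real.log b)) :=
    (intervalIntegrable_logScale hV hfin 0 (Real.log b)).1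
  simp only [hpt, Function.comp_apply]
  rw [ENNReal.ofReal_div_of_pos hlog, intervalIntegral.integral_of_le hlog.le,
    ofReal_integral_eq_lintegral_ofReal hint (ae_of_all _ fun t => logScale_nonneg _ _ _),
    restrict_Ioc_eq_restrict_Icc]

/-- With commensurable steps, a solution that is a pure exponential up to `t₁`, and whose source is a
sum of decaying exponentials from `t₁` on, does not converge. -/
theorem IsRenewalSolution.not_tendsto_of_exp_source {ι : Type*} [Fintype ι] {p a : ι → ℝ}
    {z Z : ℝ → ℝ} {d : ℕ} {s : ℝ} (h : IsRenewalSolution p a (d - s) z Z) (hs : (d : ℝ) - 1 < s)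
    {m : ι → ℕ} {h₀ : ℝ} (h₀pos : 0 < h₀) (hm : ∀ n, a n = m n * h₀) {B t₁ : ℝ} (hB : 0 < B)
    (hZ : ∀ t, t ≤ t₁ → Z t = Real.exp ((d - s) * t) * B) {κ : Fin d → ℝ}
    (hz : ∀ t, t₁ ≤ t → z t = ∑ j : Fin d, κ j * Real.exp (-(s - (j : ℕ)) * t)) (c : ℝ) :
    ¬ Tendsto Z atTop (𝓝 c) := by
  intro hc
  have hexp : ∀ j : Fin d, 0 < s - (j : ℕ) := by
    intro j
    have : ((j : ℕ) : ℝ) + 1 ≤ d := by exact_mod_cast j.2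
    linarith
  set q : Fin d → ℝ := fun j => Real.exp (-(s - (j : ℕ)) * h₀) with hq
  have hq1 : ∀ j, q j < 1 := fun j => by
    exact Real.exp_lt_one_iff.2 (by have := hexp j; nlinarith)
  set M := (∑ n, p n * m n) * c
  set B' := B * ∑ n, p n * ∑ j ∈ Finset.range (m n), Real.exp (-((d - s) * (j * h₀))) with hB'
  have hmpos : ∀ n, 0 < m n := fun n => by
    have := h.step_pos n
    rw [hm] at this
    exact_mod_cast pos_of_mul_pos_left this h₀pos.le
  have hB'pos : 0 < B' := by
    have := h.nonempty
    refine mul_pos hB (Finset.sum_pos (fun n _ => mul_pos (h.weight_pos n) ?_)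
      Finset.univ_nonempty)
    exact Finset.sum_pos (fun j _ => Real.exp_pos _)
      (Finset.nonempty_range_iff.2 (hmpos n).ne')
  -- Both sides are the limit of `∑ k < K, z (t + (k + 1) * h₀)`.
  have hid : ∀ t ∈ Icc (t₁ - h₀) t₁, M - Real.exp ((d - s) * t) * B'
      = ∑ j, κ j * Real.exp (-(s - (j : ℕ)) * t) * (q j * (1 - q j)⁻¹) := by
    intro t ht
    have h1 := h.tendsto_sum_source_of_tendsto hm h₀pos hc t
    have h2 : ∑ n, p n * ∑ j ∈ Finset.range (m n), Z (t - j * h₀)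
        = Real.exp ((d - s) * t) * B' := by
      rw [hB', Finset.mul_sum, Finset.mul_sum]
      refine Finset.sum_congr rfl fun n _ => ?_
      have : ∀ j ∈ Finset.range (m n), Z (t - j * h₀)
          = Real.exp ((d - s) * t) * B * Real.exp (-((d - s) * (j * h₀))) := by
        intro j _
        rw [hZ _ (by have : (0 : ℝ) ≤ j * h₀ := by positivity
                     linarith [ht.2]),
          show ((d : ℝ) - s) * (t - j * h₀) = (d - s) * t + -((d - s) * (j * h₀)) by ring,
          Real.exp_add]
        ring
      rw [Finset.sum_congr rfl this, ← Finset.mul_sum]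
      ring
    rw [h2] at h1
    refine tendsto_nhds_unique h1 ?_
    have h3 : ∀ K : ℕ, ∑ k ∈ Finset.range K, z (t + (k + 1) * h₀)
        = ∑ j, κ j * Real.exp (-(s - (j : ℕ)) * t) * (q j * ∑ k ∈ Finset.range K, q j ^ k) := by
      intro K
      have : ∀ k ∈ Finset.range K, z (t + (k + 1) * h₀)
          = ∑ j, κ j * Real.exp (-(s - (j : ℕ)) * t) * (q j * q j ^ k) := by
        intro k _
        rw [hz _ (by have : (0 : ℝ) ≤ k * h₀ := by positivity
                     linarith [ht.1])]
        refine Finset.sum_congr rfl fun j _ => ?_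
        rw [← pow_succ', hq, ← Real.exp_nat_mul, mul_assoc, ← Real.exp_add]
        push_cast
        ring_nf
      rw [Finset.sum_congr rfl this, Finset.sum_comm]
      simp only [← Finset.mul_sum]
    simp only [h3]
    refine tendsto_finsetSum _ fun j _ => Tendsto.const_mul _ (Tendsto.const_mul _ ?_)
    exact (hasSum_geometric_of_lt_one (Real.exp_pos _).le (hq1 j)).tendsto_sum_nat
  -- Divided by `exp ((d - s) t)`, the identity extends to all `t` by analyticity, and as `t → ∞`
  -- every term except `B'` vanishes.
  set f : ℝ → ℝ := fun t => M * Real.exp (-(d - s) * t) - B'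
    - ∑ j : Fin d, κ j * (q j * (1 - q j)⁻¹) * Real.exp (-((d : ℝ) - (j : ℕ)) * t) with hf
  have hf0 : ∀ t ∈ Icc (t₁ - h₀) t₁, f t = 0 := by
    intro t ht
    have h1 := hid t ht
    have h2 : ∑ j : Fin d, κ j * (q j * (1 - q j)⁻¹) * Real.exp (-((d : ℝ) - (j : ℕ)) * t)
        = Real.exp (-(d - s) * t) *
          ∑ j, κ j * Real.exp (-(s - (j : ℕ)) * t) * (q j * (1 - q j)⁻¹) := by
      rw [Finset.mul_sum]
      refine Finset.sum_congr rfl fun j _ => ?_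
      rw [show -((d : ℝ) - (j : ℕ)) * t = -(d - s) * t + -(s - (j : ℕ)) * t by ring, Real.exp_add]
      ring
    have h3 : Real.exp (-(d - s) * t) * Real.exp ((d - s) * t) = 1 := by
      rw [← Real.exp_add, ← add_mul, neg_add_cancel, zero_mul, Real.exp_zero]
    simp only [hf]
    rw [h2, ← h1]
    linear_combination B' * h3
  have han : AnalyticOnNhd ℝ f univ := by
    intro t _
    simp only [hf]
    fun_prop
  have hfz : f = fun _ => 0 := by
    refine han.eq_of_eventuallyEq (z₀ := t₁ - h₀ / 2) (fun _ _ => analyticAt_const) ?_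
    filter_upwards [Icc_mem_nhds (by linarith : t₁ - h₀ < t₁ - h₀ / 2)
      (by linarith : t₁ - h₀ / 2 < t₁)] with t ht using hf0 t ht
  have hdecay : ∀ b : ℝ, 0 < b → Tendsto (fun t => Real.exp (-b * t)) atTop (𝓝 0) := by
    intro b hb
    refine Real.tendsto_exp_atBot.comp ?_
    exact tendsto_id.const_mul_atTop_of_neg (neg_lt_zero.2 hb)
  have hlim : Tendsto f atTop (𝓝 (M * 0 - B' - ∑ j : Fin d, κ j * (q j * (1 - q j)⁻¹) * 0)) := by
    refine (((hdecay _ h.rate_pos).const_mul M).sub_const B').sub ?_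
    refine tendsto_finsetSum _ fun j _ => (hdecay _ ?_).const_mul _
    have : ((j : ℕ) : ℝ) < d := by exact_mod_cast j.2
    linarith
  rw [hfz] at hlim
  have := tendsto_nhds_unique hlim tendsto_const_nhds
  simp at this
  exact hB'pos.ne' this

/-! ### Volume estimates and the dimension -/

theorem monotone_parallelVolume {d : ℕ} (A : Set (EuclideanSpace ℝ (Fin d))) :
    Monotone (parallelVolume A) := fun _ _ h => measure_mono (Metric.cthickening_mono h _)

theorem monotone_outerParallelVolume {d : ℕ} (A : Set (EuclideanSpace ℝ (Fin d))) :
    Monotone (outerParallelVolume A) := fun _ _ h =>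
  tsub_le_tsub_right (measure_mono (Metric.cthickening_mono h _)) _

theorem monotone_innerParallelVolume {d : ℕ} (A : Set (EuclideanSpace ℝ (Fin d))) :
    Monotone (innerParallelVolume A) := fun _ _ h =>
  measure_mono (inter_subset_inter_right _ (Metric.cthickening_mono h _))

theorem parallelVolume_ne_top {d : ℕ} {A : Set (EuclideanSpace ℝ (Fin d))}
    (hA : Bornology.IsBounded A) (ε : ℝ) : parallelVolume A ε ≠ ∞ :=
  hA.cthickening.measure_lt_top.ne

theorem outerParallelVolume_ne_top {d : ℕ} {A : Set (EuclideanSpace ℝ (Fin d))}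
    (hA : Bornology.IsBounded A) (ε : ℝ) : outerParallelVolume A ε ≠ ∞ :=
  ne_top_of_le_ne_top (parallelVolume_ne_top hA ε) tsub_le_self

theorem innerParallelVolume_ne_top {d : ℕ} {A : Set (EuclideanSpace ℝ (Fin d))}
    (hA : Bornology.IsBounded A) (ε : ℝ) : innerParallelVolume A ε ≠ ∞ :=
  (hA.subset inter_subset_left).measure_lt_top.ne

namespace SelfSimilarSystem

variable {d N : ℕ} {S : SelfSimilarSystem d N} {F O G : Set (EuclideanSpace ℝ (Fin d))}

theorem neg_log_ratio_pos (S : SelfSimilarSystem d N) (n : Fin N) : 0 < -Real.log (S.ratio n) :=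
  neg_pos.2 (Real.log_neg (S.ratio_pos n) (S.ratio_lt_one n))

theorem exists_step_bound (S : SelfSimilarSystem d N) : ∃ A, ∀ n, -Real.log (S.ratio n) ≤ A :=
  ⟨∑ n, -Real.log (S.ratio n), fun n =>
    Finset.single_le_sum (f := fun n => -Real.log (S.ratio n))
      (fun m _ => (S.neg_log_ratio_pos m).le) (Finset.mem_univ n)⟩

/-- In a nonlattice system the logarithms of the ratios generate a dense subgroup of `ℝ`. -/
theorem dense_closure_of_not_isLattice (hS : ¬ S.IsLattice) :
    Dense (AddSubgroup.closure (range fun n => -Real.log (S.ratio n)) : Set ℝ) := by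
  refine (AddSubgroup.dense_or_cyclic _).resolve_right ?_
  rintro ⟨x, hx⟩
  refine hS ⟨Real.exp (-x), Real.exp_pos _, fun n => ?_⟩
  have h1 : -Real.log (S.ratio n) ∈ AddSubgroup.closure {x} := by
    rw [← hx]; exact AddSubgroup.subset_closure ⟨n, rfl⟩
  obtain ⟨k, hk⟩ := AddSubgroup.mem_closure_singleton.1 h1
  refine ⟨k, ?_⟩
  rw [← Real.rpow_intCast, ← Real.exp_mul, neg_mul, mul_comm, ← zsmul_eq_mul, hk, neg_neg,
    Real.exp_log (S.ratio_pos n)]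

namespace IsMonogenic

theorem isBounded_sUnion_tiling (h : S.IsMonogenic F O G) : Bornology.IsBounded (⋃₀ S.tiling O) :=
  h.isBounded.subset h.sUnion_tiling_subset

theorem isBounded_generator (h : S.IsMonogenic F O G) : Bornology.IsBounded G :=
  h.isBounded.subset h.generator_subset

theorem isBounded_attractor (h : S.IsMonogenic F O G) : Bornology.IsBounded F :=
  h.attractor.2.1.isBounded

theorem exists_similarity_dim (h : S.IsMonogenic F O G) :
    ∃ s : ℝ, 0 < s ∧ s < d ∧ ∑ n, S.ratio n ^ s = 1 := by
  have h0 : (1 : ℝ) < ∑ n, S.ratio n ^ (0 : ℝ) := by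
    have : (2 : ℝ) ≤ N := by exact_mod_cast S.two_le
    simp only [Real.rpow_zero, Finset.sum_const, Finset.card_univ, Fintype.card_fin,
      nsmul_eq_mul, mul_one]
    linarith
  have h1 : ∑ n, S.ratio n ^ (d : ℝ) < 1 := by
    simpa only [Real.rpow_natCast] using h.sum_ratio_pow_lt_one
  have hcont : Continuous fun s : ℝ => ∑ n, S.ratio n ^ s :=
    continuous_finsetSum _ fun n _ => Real.continuous_const_rpow (S.ratio_pos n).ne'
  obtain ⟨s, ⟨hs0, hsd⟩, hs⟩ := intermediate_value_Icc' (Nat.cast_nonneg (α := ℝ) d)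
    hcont.continuousOn ⟨h1.le, h0.le⟩
  refine ⟨s, lt_of_le_of_ne hs0 ?_, lt_of_le_of_ne hsd ?_, hs⟩
  · rintro rfl
    exact h0.ne' hs
  · rintro rfl
    exact h1.ne hs

theorem parallelVolume_le (h : S.IsMonogenic F O G) (ε : ℝ) :
    parallelVolume F ε
      ≤ ∑ n, ENNReal.ofReal (S.ratio n ^ d) * parallelVolume F (ε / S.ratio n) := by
  have hsub : Metric.cthickening ε F ⊆ ⋃ n, Metric.cthickening ε (S.map n '' F) := by
    intro x hx
    obtain ⟨i, -, -⟩ := S.exists_ne_index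
    have : Nonempty (Fin N) := ⟨i⟩
    rw [Metric.mem_cthickening_iff, h.attractor.2.2, setMap, Metric.infEDist_iUnion] at hx
    obtain ⟨n, hn⟩ := exists_eq_ciInf_of_finite (f := fun n => Metric.infEDist x (S.map n '' F))
    exact mem_iUnion.2 ⟨n, Metric.mem_cthickening_iff.2 (hn.trans_le hx)⟩
  refine (measure_mono hsub).trans ((measure_iUnion_fintype_le _ _).trans_eq ?_)
  refine Finset.sum_congr rfl fun n _ => ?_
  rw [← S.image_cthickening, S.volume_image, parallelVolume]

variable {s : ℝ}

theorem logScale_attractor_le (h : S.IsMonogenic F O G) (t : ℝ) :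
    logScale (d - s) (parallelVolume F) t ≤ ∑ n, S.ratio n ^ s *
      logScale (d - s) (parallelVolume F) (t - -Real.log (S.ratio n)) := by
  have hfin := parallelVolume_ne_top h.isBounded_attractor
  simp only [rpow_mul_logScale_sub (S.ratio_pos _), ← Finset.mul_sum]
  refine mul_le_mul_of_nonneg_left ?_ (Real.exp_pos _).le
  have hne : ∀ n ∈ Finset.univ, ENNReal.ofReal (S.ratio n ^ d) *
      parallelVolume F (Real.exp (-t) / S.ratio n) ≠ ∞ :=
    fun n _ => ENNReal.mul_ne_top ENNReal.ofReal_ne_top (hfin _)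
  refine (ENNReal.toReal_mono (ENNReal.sum_ne_top.2 hne) (h.parallelVolume_le _)).trans_eq ?_
  rw [ENNReal.toReal_sum hne]
  refine Finset.sum_congr rfl fun n _ => ?_
  rw [ENNReal.toReal_mul, ENNReal.toReal_ofReal (pow_pos (S.ratio_pos n) d).le]

theorem logScale_tiling_eq (h : S.IsMonogenic F O G) (t : ℝ) :
    logScale (d - s) (innerParallelVolume (⋃₀ S.tiling O)) t
      = logScale (d - s) (innerParallelVolume G) t + ∑ n, S.ratio n ^ s *
        logScale (d - s) (innerParallelVolume (⋃₀ S.tiling O))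
          (t - -Real.log (S.ratio n)) := by
  have hfin := innerParallelVolume_ne_top h.isBounded_sUnion_tiling
  have hne : ∀ n ∈ Finset.univ, ENNReal.ofReal (S.ratio n ^ d) *
      innerParallelVolume (⋃₀ S.tiling O) (Real.exp (-t) / S.ratio n) ≠ ∞ :=
    fun n _ => ENNReal.mul_ne_top ENNReal.ofReal_ne_top (hfin _)
  simp only [rpow_mul_logScale_sub (S.ratio_pos _), ← Finset.mul_sum]
  rw [logScale, logScale, ← mul_add]
  congr 1
  have h1 := h.volume_tiling_inter (Real.exp (-t))
  simp only [← h.innerParallelVolume_tiling, ← h.innerParallelVolume_generator] at h1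
  rw [h1, ENNReal.toReal_add (innerParallelVolume_ne_top h.isBounded_generator _)
    (ENNReal.sum_ne_top.2 hne), ENNReal.toReal_sum hne]
  congr 1
  refine Finset.sum_congr rfl fun n _ => ?_
  rw [ENNReal.toReal_mul, ENNReal.toReal_ofReal (pow_pos (S.ratio_pos n) d).le]

theorem logScale_attractor_eq (h : S.IsMonogenic F O G) (t : ℝ) :
    logScale (d - s) (parallelVolume F) t
      = logScale (d - s) (innerParallelVolume (⋃₀ S.tiling O)) t
        + logScale (d - s) (outerParallelVolume (closure O)) t := by
  rw [logScale, h.parallelVolume_eq, ENNReal.toReal_add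
    (innerParallelVolume_ne_top h.isBounded_sUnion_tiling _)
    (outerParallelVolume_ne_top h.isBounded.closure _), mul_add]
  rfl

theorem logScale_tiling_le (h : S.IsMonogenic F O G) (t : ℝ) :
    logScale (d - s) (innerParallelVolume (⋃₀ S.tiling O)) t
      ≤ logScale (d - s) (parallelVolume F) t := by
  rw [h.logScale_attractor_eq]
  exact le_add_of_nonneg_right (logScale_nonneg _ _ _)

theorem inradius_le_exp_neg (h : S.IsMonogenic F O G) (hd : 0 < d) {t : ℝ}
    (ht : t ≤ -Real.log (inradius G)) : inradius G ≤ Real.exp (-t) := by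
  rw [← Real.log_le_iff_le_exp (h.inradius_pos hd)]
  linarith

theorem exp_neg_le_inradius (h : S.IsMonogenic F O G) (hd : 0 < d) {t : ℝ}
    (ht : -Real.log (inradius G) ≤ t) : Real.exp (-t) ≤ inradius G := by
  rw [← Real.le_log_iff_exp_le (h.inradius_pos hd)]
  linarith

theorem logScale_tiling_of_le (h : S.IsMonogenic F O G) (hd : 0 < d) {t : ℝ}
    (ht : t ≤ -Real.log (inradius G)) :
    logScale (d - s) (innerParallelVolume (⋃₀ S.tiling O)) t
      = Real.exp ((d - s) * t) * (volume (⋃₀ S.tiling O)).toReal := by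
  rw [logScale, h.innerParallelVolume_tiling, inter_eq_self_of_subset_left
    (h.sUnion_tiling_subset_cthickening hd (h.inradius_le_exp_neg hd ht))]

theorem logScale_generator_of_le (h : S.IsMonogenic F O G) (hd : 0 < d) {t : ℝ}
    (ht : t ≤ -Real.log (inradius G)) :
    logScale (d - s) (innerParallelVolume G) t
      = Real.exp ((d - s) * t) * (volume G).toReal := by
  rw [logScale, h.innerParallelVolume_generator, inter_eq_self_of_subset_left
    (h.generator_subset_sUnion.trans
      (h.sUnion_tiling_subset_cthickening hd (h.inradius_le_exp_neg hd ht)))]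

theorem volume_generator_toReal_pos (h : S.IsMonogenic F O G) : 0 < (volume G).toReal :=
  ENNReal.toReal_pos h.volume_generator_pos.ne' h.isBounded_generator.measure_lt_top.ne

theorem volume_sUnion_tiling_toReal_pos (h : S.IsMonogenic F O G) :
    0 < (volume (⋃₀ S.tiling O)).toReal :=
  ENNReal.toReal_pos
    (h.volume_generator_pos.trans_le (measure_mono h.generator_subset_sUnion)).ne'
    h.isBounded_sUnion_tiling.measure_lt_top.ne

/-- The parallel volume of `F` is at most of order `ε ^ (d - s)`, where `s` is the similarity
dimension. -/
theorem exists_upper_bound (h : S.IsMonogenic F O G) (hsd : s < d)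
    (hs : ∑ n, S.ratio n ^ s = 1) :
    ∃ C, ∀ t, 0 ≤ t → logScale (d - s) (parallelVolume F) t ≤ C := by
  obtain ⟨i, -, -⟩ := S.exists_ne_index
  have : Nonempty (Fin N) := ⟨i⟩
  obtain ⟨A, hA⟩ := S.exists_step_bound
  have hfin := parallelVolume_ne_top h.isBounded_attractor
  refine ⟨Real.exp ((d - s) * A) * (parallelVolume F 1).toReal, fun t ht => ?_⟩
  refine le_of_renewal_le (t₁ := A) (fun n => Real.rpow_pos_of_pos (S.ratio_pos n) s) hs
    S.neg_log_ratio_pos hA (fun t _ => h.logScale_attractor_le t) (fun t ht => ?_) (by simpa)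
  have ht0 : 0 ≤ t := by simpa using ht.1
  refine mul_le_mul (Real.exp_le_exp.2 (mul_le_mul_of_nonneg_left ht.2 (by linarith))) ?_
    ENNReal.toReal_nonneg (Real.exp_pos _).le
  refine ENNReal.toReal_mono (hfin _) (monotone_parallelVolume F ?_)
  exact Real.exp_le_one_iff.2 (neg_nonpos.2 ht0)

/-- The inner parallel volume of the tiling is at least of order `ε ^ (d - s)`, where `s` is the
similarity dimension. -/
theorem exists_lower_bound (h : S.IsMonogenic F O G) (hd : 0 < d) (hsd : s < d)
    (hs : ∑ n, S.ratio n ^ s = 1) :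
    ∃ c, 0 < c ∧ ∀ᶠ t in atTop,
      c ≤ logScale (d - s) (innerParallelVolume (⋃₀ S.tiling O)) t := by
  obtain ⟨i, -, -⟩ := S.exists_ne_index
  have : Nonempty (Fin N) := ⟨i⟩
  obtain ⟨A, hA⟩ := S.exists_step_bound
  set t₁ := -Real.log (inradius G)
  set c := Real.exp ((d - s) * (t₁ - A)) * (volume (⋃₀ S.tiling O)).toReal with hc
  refine ⟨c, mul_pos (Real.exp_pos _) h.volume_sUnion_tiling_toReal_pos, ?_⟩
  filter_upwards [eventually_ge_atTop (t₁ - A)] with t ht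
  have := le_of_renewal_le (C := -c)
    (Y := fun t => -logScale (d - s) (innerParallelVolume (⋃₀ S.tiling O)) t)
    (fun n => Real.rpow_pos_of_pos (S.ratio_pos n) s) hs S.neg_log_ratio_pos hA
    (fun t _ => ?_) (fun t ht => ?_) ht
  · linarith
  · rw [h.logScale_tiling_eq t]
    have := logScale_nonneg (d - s) (innerParallelVolume G) t
    simp only [mul_neg, Finset.sum_neg_distrib]
    linarith
  · rw [h.logScale_tiling_of_le hd ht.2, neg_le_neg_iff]
    refine mul_le_mul_of_nonneg_right (Real.exp_le_exp.2 ?_) ENNReal.toReal_nonneg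
    exact mul_le_mul_of_nonneg_left ht.1 (by linarith)

theorem hasMinkowskiContent_zero (h : S.IsMonogenic F O G) (hsd : s < d)
    (hs : ∑ n, S.ratio n ^ s = 1) {α : ℝ} (hα : s < α) : HasMinkowskiContent α F 0 := by
  have hfin := parallelVolume_ne_top h.isBounded_attractor
  obtain ⟨C, hC⟩ := h.exists_upper_bound hsd hs
  rw [← ENNReal.ofReal_zero]
  refine HasContent.of_tendsto hfin ?_
  have hlim : Tendsto (fun t => Real.exp ((s - α) * t) * C) atTop (𝓝 (0 * C)) := by
    refine Tendsto.mul_const C (Real.tendsto_exp_atBot.comp ?_)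
    exact tendsto_id.const_mul_atTop_of_neg (by linarith)
  rw [zero_mul] at hlim
  refine squeeze_zero' (Eventually.of_forall fun t => logScale_nonneg _ _ _) ?_ hlim
  filter_upwards [eventually_ge_atTop 0] with t ht
  rw [logScale_eq_exp_mul (d - s), show (d : ℝ) - α - (d - s) = s - α by ring]
  exact mul_le_mul_of_nonneg_left (hC t ht) (Real.exp_pos _).le

theorem exists_lower_bound_of_le (h : S.IsMonogenic F O G) (hd : 0 < d) (hsd : s < d)
    (hs : ∑ n, S.ratio n ^ s = 1) :
    ∃ c, 0 < c ∧ ∀ α ≤ s, ∀ᶠ t in atTop,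
      Real.exp ((s - α) * t) * c ≤ logScale (d - α) (parallelVolume F) t := by
  obtain ⟨c, hc, hlow⟩ := h.exists_lower_bound hd hsd hs
  refine ⟨c, hc, fun α hα => hlow.mono fun t ht => ?_⟩
  rw [logScale_eq_exp_mul (d - s), show (d : ℝ) - α - (d - s) = s - α by ring]
  exact mul_le_mul_of_nonneg_left (ht.trans (h.logScale_tiling_le t)) (Real.exp_pos _).le

/-- The Minkowski dimension is the similarity dimension. -/
theorem minkowskiDim_eq (h : S.IsMonogenic F O G) (hd : 0 < d) (hs0 : 0 < s) (hsd : s < d)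
    (hs : ∑ n, S.ratio n ^ s = 1) : minkowskiDim F = s := by
  have hfin := parallelVolume_ne_top h.isBounded_attractor
  have hset : {α : ℝ | 0 ≤ α ∧ HasMinkowskiContent α F 0} = Ioi s := by
    ext α
    refine ⟨fun ⟨_, hα⟩ => ?_, fun hα => ⟨hs0.le.trans (le_of_lt hα),
      h.hasMinkowskiContent_zero hsd hs hα⟩⟩
    by_contra hle
    rw [mem_Ioi, not_lt] at hle
    obtain ⟨c, hc, hlow⟩ := h.exists_lower_bound_of_le hd hsd hs
    have hlim := HasContent.tendsto hfin ENNReal.zero_ne_top hα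
    have hge : c ≤ (0 : ℝ≥0∞).toReal := by
      refine ge_of_tendsto hlim ?_
      filter_upwards [hlow α hle, eventually_ge_atTop 0] with t ht ht0
      refine le_trans ?_ ht
      refine le_mul_of_one_le_left hc.le (Real.one_le_exp ?_)
      exact mul_nonneg (sub_nonneg.2 hle) ht0
    rw [ENNReal.toReal_zero] at hge
    exact absurd hc (not_lt.2 hge)
  rw [minkowskiDim, hset, csInf_Ioi]

/-- A positive finite Minkowski content can only occur in the similarity dimension. -/
theorem eq_of_hasMinkowskiContent (h : S.IsMonogenic F O G) (hd : 0 < d) (hsd : s < d)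
    (hs : ∑ n, S.ratio n ^ s = 1) {α : ℝ} {c : ℝ≥0∞} (hα : HasMinkowskiContent α F c)
    (hc0 : 0 < c) (hc : c < ∞) : α = s := by
  have hfin := parallelVolume_ne_top h.isBounded_attractor
  rcases lt_trichotomy α s with hlt | heq | hgt
  · obtain ⟨c', hc', hlow⟩ := h.exists_lower_bound_of_le hd hsd hs
    refine absurd (HasContent.tendsto hfin hc.ne hα) (not_tendsto_nhds_of_tendsto_atTop ?_ _)
    refine tendsto_atTop_mono' _ (hlow α hlt.le) (Tendsto.atTop_mul_const hc' ?_)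
    exact Real.tendsto_exp_atTop.comp (tendsto_id.const_mul_atTop (sub_pos.2 hlt))
  · exact heq
  · exact absurd (tendsto_nhds_unique hα (h.hasMinkowskiContent_zero hsd hs hgt)) hc0.ne'

/-! ### The source term of a monophase generator -/

/-- The constant coefficient of the inner parallel volume is its limit at `0`, hence zero. -/
theorem coeff_last_eq_zero (h : S.IsMonogenic F O G) (hd : 0 < d) {κ : Fin (d + 1) → ℝ}
    (hκ : IsMonophaseRepresentation G κ) : κ (Fin.last d) = 0 := by
  have hg := h.inradius_pos hd
  have h1 : Tendsto (fun ε : ℝ => ∑ k : Fin (d + 1), κ k * ε ^ (d - (k : ℕ))) (𝓝[>] 0)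
      (𝓝 (∑ k : Fin (d + 1), κ k * 0 ^ (d - (k : ℕ)))) := by
    refine Tendsto.mono_left (Continuous.tendsto ?_ 0) nhdsWithin_le_nhds
    fun_prop
  have h2 : ∑ k : Fin (d + 1), κ k * (0 : ℝ) ^ (d - (k : ℕ)) = κ (Fin.last d) := by
    rw [Fin.sum_univ_castSucc, Finset.sum_eq_zero, zero_add]
    · simp
    · intro j _
      rw [Fin.val_castSucc, zero_pow (Nat.sub_ne_zero_of_lt j.2), mul_zero]
  rw [h2] at h1
  have h3 : Tendsto (fun ε => (innerParallelVolume G ε).toReal) (𝓝[>] 0) (𝓝 0) := by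
    have h4 : Tendsto (innerParallelVolume G) (𝓝 0) (𝓝 0) := by
      have h5 := tendsto_measure_cthickening_of_isCompact (μ := volume) h.attractor.2.1
      rw [h.volume_attractor] at h5
      refine tendsto_of_tendsto_of_tendsto_of_le_of_le tendsto_const_nhds h5
        (fun _ => zero_le) fun ε => ?_
      rw [h.innerParallelVolume_generator]
      exact measure_mono inter_subset_right
    have := (ENNReal.tendsto_toReal ENNReal.zero_ne_top).comp h4
    exact this.mono_left nhdsWithin_le_nhds
  refine tendsto_nhds_unique h1 (h3.congr' ?_)
  filter_upwards [Ioc_mem_nhdsGT hg] with ε hε using hκ ε hε.1 hε.2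

/-- The substitution `ε = exp (-t)` in the monophase representation; `κ` has no constant term. -/
theorem logScale_generator_of_ge (h : S.IsMonogenic F O G) (hd : 0 < d) {κ : Fin (d + 1) → ℝ}
    (hκ : IsMonophaseRepresentation G κ) {t : ℝ} (ht : -Real.log (inradius G) ≤ t) :
    logScale (d - s) (innerParallelVolume G) t
      = ∑ j : Fin d, κ j.castSucc * Real.exp (-(s - (j : ℕ)) * t) := by
  rw [logScale, hκ _ (Real.exp_pos _) (h.exp_neg_le_inradius hd ht), Fin.sum_univ_castSucc,
    h.coeff_last_eq_zero hd hκ, zero_mul, add_zero, Finset.mul_sum]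
  refine Finset.sum_congr rfl fun j _ => ?_
  rw [Fin.val_castSucc, ← Real.exp_nat_mul, mul_left_comm, ← Real.exp_add, Nat.cast_sub j.2.le]
  ring_nf

/-- The two formulas for the source agree at the inradius. -/
theorem volume_generator_eq (h : S.IsMonogenic F O G) (hd : 0 < d) {κ : Fin (d + 1) → ℝ}
    (hκ : IsMonophaseRepresentation G κ) :
    Real.exp ((d - s) * -Real.log (inradius G)) * (volume G).toReal
      = ∑ j : Fin d, κ j.castSucc * inradius G ^ (s - (j : ℕ)) := by
  rw [← h.logScale_generator_of_le hd le_rfl, h.logScale_generator_of_ge hd hκ le_rfl]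
  refine Finset.sum_congr rfl fun j _ => ?_
  rw [Real.rpow_def_of_pos (h.inradius_pos hd)]
  ring_nf

theorem sub_index_pos (hs : (d : ℝ) - 1 < s) (j : Fin d) : 0 < s - (j : ℕ) := by
  have : ((j : ℕ) : ℝ) + 1 ≤ d := by exact_mod_cast j.2
  linarith

theorem integrableOn_generator_Iic (h : S.IsMonogenic F O G) (hd : 0 < d) (hsd : s < d) :
    IntegrableOn (logScale (d - s) (innerParallelVolume G)) (Iic (-Real.log (inradius G))) :=
  IntegrableOn.congr_fun ((integrableOn_exp_mul_Iic (sub_pos.2 hsd) _).mul_const _)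
    (fun _ ht => (h.logScale_generator_of_le hd ht).symm) measurableSet_Iic

theorem integrableOn_generator_Ioi (h : S.IsMonogenic F O G) (hd : 0 < d)
    (hs : (d : ℝ) - 1 < s) (hmono : IsMonophase G) :
    IntegrableOn (logScale (d - s) (innerParallelVolume G)) (Ioi (-Real.log (inradius G))) := by
  obtain ⟨κ, hκ⟩ := hmono
  have : IntegrableOn (fun t => ∑ j : Fin d, κ j.castSucc * Real.exp (-(s - (j : ℕ)) * t))
      (Ioi (-Real.log (inradius G))) :=
    integrable_finsetSum _ fun j _ =>
      (integrableOn_exp_mul_Ioi (neg_lt_zero.2 (sub_index_pos hs j)) _).const_mul _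
  exact this.congr_fun (fun t ht => (h.logScale_generator_of_ge hd hκ (le_of_lt ht)).symm)
    measurableSet_Ioi

theorem integrable_generator (h : S.IsMonogenic F O G) (hd : 0 < d) (hsd : s < d)
    (hs : (d : ℝ) - 1 < s) (hmono : IsMonophase G) :
    Integrable (logScale (d - s) (innerParallelVolume G)) := by
  rw [← integrableOn_univ, ← Iic_union_Ioi (a := -Real.log (inradius G))]
  exact (h.integrableOn_generator_Iic hd hsd).union (h.integrableOn_generator_Ioi hd hs hmono)

theorem tendsto_generator (h : S.IsMonogenic F O G) (hd : 0 < d) (hs : (d : ℝ) - 1 < s)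
    (hmono : IsMonophase G) :
    Tendsto (logScale (d - s) (innerParallelVolume G)) atTop (𝓝 0) := by
  obtain ⟨κ, hκ⟩ := hmono
  have h1 : Tendsto (fun t => ∑ j : Fin d, κ j.castSucc * Real.exp (-(s - (j : ℕ)) * t)) atTop
      (𝓝 (∑ j : Fin d, κ j.castSucc * 0)) := by
    refine tendsto_finsetSum _ fun j _ => Tendsto.const_mul _ (Real.tendsto_exp_atBot.comp ?_)
    exact tendsto_id.const_mul_atTop_of_neg (neg_lt_zero.2 (sub_index_pos hs j))
  simp only [mul_zero, Finset.sum_const_zero] at h1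
  refine h1.congr' ?_
  filter_upwards [eventually_ge_atTop (-Real.log (inradius G))] with t ht
  exact (h.logScale_generator_of_ge hd hκ ht).symm

/-- The two ranges of `t` contribute `∑ j, κ j * g ^ (s - j)` times `1 / (d - s)` and `1 / (s - j)`
respectively; the terms combine to those of `gammaCoeff`. -/
theorem integral_generator (h : S.IsMonogenic F O G) (hd : 0 < d) (hsd : s < d)
    (hs : (d : ℝ) - 1 < s) {κ : Fin (d + 1) → ℝ} (hκ : IsMonophaseRepresentation G κ) :
    ∫ t, logScale (d - s) (innerParallelVolume G) t = gammaCoeff G κ s / (d - s) := by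
  have hds : (0 : ℝ) < d - s := sub_pos.2 hsd
  have hneg : ∀ j : Fin d, -(s - (j : ℕ)) < 0 := fun j => neg_lt_zero.2 (sub_index_pos hs j)
  rw [← intervalIntegral.integral_Iic_add_Ioi (b := -Real.log (inradius G))
    (h.integrableOn_generator_Iic hd hsd) (h.integrableOn_generator_Ioi hd hs ⟨κ, hκ⟩),
    setIntegral_congr_fun measurableSet_Iic fun t ht => h.logScale_generator_of_le hd ht,
    setIntegral_congr_fun measurableSet_Ioi fun t ht =>
      h.logScale_generator_of_ge hd hκ (le_of_lt ht),
    integral_finsetSum _ fun j _ => (integrableOn_exp_mul_Ioi (hneg j) _).const_mul _,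
    integral_mul_const, integral_exp_mul_Iic hds, div_mul_eq_mul_div,
    h.volume_generator_eq hd hκ, Finset.sum_div, ← Finset.sum_add_distrib, gammaCoeff,
    Finset.sum_div]
  refine Finset.sum_congr rfl fun j _ => ?_
  have hsj := sub_index_pos hs j
  have hexp : Real.exp (-(s - (j : ℕ)) * -Real.log (inradius G))
      = inradius G ^ (s - (j : ℕ)) := by
    rw [Real.rpow_def_of_pos (h.inradius_pos hd)]; ring_nf
  rw [integral_const_mul, integral_exp_mul_Ioi (hneg j), hexp]
  field_simp
  ring

theorem integral_generator_pos (h : S.IsMonogenic F O G) (hd : 0 < d) (hsd : s < d)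
    (hs : (d : ℝ) - 1 < s) (hmono : IsMonophase G) :
    0 < ∫ t, logScale (d - s) (innerParallelVolume G) t := by
  have hds : (0 : ℝ) < d - s := sub_pos.2 hsd
  rw [← intervalIntegral.integral_Iic_add_Ioi (b := -Real.log (inradius G))
    (h.integrableOn_generator_Iic hd hsd) (h.integrableOn_generator_Ioi hd hs hmono),
    setIntegral_congr_fun measurableSet_Iic fun t ht => h.logScale_generator_of_le hd ht,
    integral_mul_const, integral_exp_mul_Iic hds]
  refine add_pos_of_pos_of_nonneg
    (mul_pos (div_pos (Real.exp_pos _) hds) h.volume_generator_toReal_pos) ?_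
  exact setIntegral_nonneg measurableSet_Ioi fun t _ => logScale_nonneg _ _ _

/-! ### Minkowski contents of the attractor and of the tiling -/

/-- The rescaled inner parallel volume of the tiling solves the renewal equation whose weights are
the `s`-th powers of the ratios and whose source is the rescaled volume of the generator. -/
theorem isRenewalSolution (h : S.IsMonogenic F O G) (hd : 0 < d) (hsd : s < d)
    (hs : (d : ℝ) - 1 < s) (hsum : ∑ n, S.ratio n ^ s = 1) (hmono : IsMonophase G) :
    IsRenewalSolution (fun n => S.ratio n ^ s) (fun n => -Real.log (S.ratio n)) (d - s)
      (logScale (d - s) (innerParallelVolume G))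
      (logScale (d - s) (innerParallelVolume (⋃₀ S.tiling O))) where
  weight_pos n := Real.rpow_pos_of_pos (S.ratio_pos n) s
  weight_sum := hsum
  step_pos := S.neg_log_ratio_pos
  rate_pos := sub_pos.2 hsd
  nonneg := logScale_nonneg _ _
  bounded := by
    obtain ⟨C, hC⟩ := h.exists_upper_bound hsd hsum
    refine ⟨max C (volume (⋃₀ S.tiling O)).toReal, fun t => ?_⟩
    rcases le_total 0 t with ht | ht
    · exact ((h.logScale_tiling_le t).trans (hC t ht)).trans (le_max_left _ _)
    · refine le_trans ?_ (le_max_right _ _)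
      rw [logScale, ← one_mul (volume (⋃₀ S.tiling O)).toReal]
      refine mul_le_mul (Real.exp_le_one_iff.2 ?_) (ENNReal.toReal_mono
        h.isBounded_sUnion_tiling.measure_lt_top.ne (measure_mono inter_subset_left))
        ENNReal.toReal_nonneg zero_le_one
      exact mul_nonpos_of_nonneg_of_nonpos (sub_pos.2 hsd).le ht
  growth t _ hs' := logScale_add_le (monotone_innerParallelVolume _)
    (innerParallelVolume_ne_top h.isBounded_sUnion_tiling) t hs'
  integrableOn T := by
    have h1 : IntegrableOn (logScale (d - s) (innerParallelVolume (⋃₀ S.tiling O)))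
        (Iic (-Real.log (inradius G))) :=
      IntegrableOn.congr_fun ((integrableOn_exp_mul_Iic (sub_pos.2 hsd) _).mul_const _)
        (fun _ ht => (h.logScale_tiling_of_le hd ht).symm) measurableSet_Iic
    have h2 := (intervalIntegrable_logScale (γ := d - s)
      (monotone_innerParallelVolume (⋃₀ S.tiling O))
      (innerParallelVolume_ne_top h.isBounded_sUnion_tiling) (-Real.log (inradius G)) T).1
    refine (h1.union h2).mono_set fun t ht => ?_
    rcases le_or_gt t (-Real.log (inradius G)) with h3 | h3
    · exact Or.inl h3
    · exact Or.inr ⟨h3, ht⟩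
  source_integrable := h.integrable_generator hd hsd hs hmono
  source_tendsto := h.tendsto_generator hd hs hmono
  equation := h.logScale_tiling_eq

/-- In the lattice case, the rescaled tiling volume does not converge. -/
theorem not_tendsto_of_isLattice (h : S.IsMonogenic F O G) (hd : 0 < d) (hsd : s < d)
    (hs : (d : ℝ) - 1 < s) (hsum : ∑ n, S.ratio n ^ s = 1) (hmono : IsMonophase G)
    (hS : S.IsLattice) (c : ℝ) :
    ¬ Tendsto (logScale (d - s) (innerParallelVolume (⋃₀ S.tiling O))) atTop (𝓝 c) := by
  obtain ⟨κ, hκ⟩ := id hmono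
  obtain ⟨r, hr, hk⟩ := hS
  choose k hk using hk
  have hm : ∀ n, -Real.log (S.ratio n) = (k n).natAbs * |Real.log r| := by
    intro n
    rw [← abs_of_pos (S.neg_log_ratio_pos n), hk, Real.log_zpow, abs_neg, abs_mul,
      Nat.cast_natAbs, Int.cast_abs]
  obtain ⟨i, -, -⟩ := S.exists_ne_index
  have hpos : 0 < |Real.log r| := by
    have h1 := S.neg_log_ratio_pos i
    rw [hm] at h1
    exact pos_of_mul_pos_right h1 (Nat.cast_nonneg _)
  exact (h.isRenewalSolution hd hsd hs hsum hmono).not_tendsto_of_exp_source hs hpos hm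
    h.volume_sUnion_tiling_toReal_pos (fun t ht => h.logScale_tiling_of_le hd ht)
    (fun t ht => h.logScale_generator_of_ge hd hκ ht) c

end IsMonogenic

end SelfSimilarSystem

theorem theorem5p4 {d N : ℕ} (S : SelfSimilarSystem d N)
    (F : Set (EuclideanSpace ℝ (Fin d))) (hF : S.IsAttractor F)
    (D : ℝ) (hD : minkowskiDim F = D) (hD_gt : (d : ℝ) - 1 < D) (hD_lt : D < d)
    (O : Set (EuclideanSpace ℝ (Fin d))) (hO : S.IsFeasible O) (hOF : frontier O ⊆ F)
    (G : Set (EuclideanSpace ℝ (Fin d))) (hG : S.generators O = {G}) (hmono : IsMonophase G)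
    (MK : ℝ≥0) (hK : HasOuterMinkowskiContent D (closure O) MK) :
    (IsMinkowskiMeasurable F ↔ ¬ S.IsLattice) ∧
    (¬ S.IsLattice →
      ∃ MF MT : ℝ≥0∞,
        HasMinkowskiContent D F MF ∧
        HasTilingMinkowskiContent D (S.tiling O) MT ∧
        MF = MT + MK ∧
        0 < MF ∧ MF < ∞ ∧ 0 < MT ∧ MT < ∞) ∧
    (S.IsLattice →
      (¬ ∃ c : ℝ≥0∞, HasMinkowskiContent D F c) ∧
      ∃ AF AT : ℝ≥0∞,
        HasAverageMinkowskiContent D F AF ∧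
        HasTilingAverageMinkowskiContent D (S.tiling O) AT ∧
        AF = AT + MK ∧
        0 < AF ∧ AF < ∞ ∧ 0 < AT ∧ AT < ∞ ∧
        ∀ (κ : Fin (d + 1) → ℝ) (r : ℝ) (k : Fin N → ℤ),
          IsMonophaseRepresentation G κ → 0 < r → (∀ n, S.ratio n = r ^ k n) →
          AT = ENNReal.ofReal
            (gammaCoeff G κ D /
              (((d : ℝ) - D) * ∑ n, r ^ ((k n : ℝ) * D) * (k n : ℝ) * Real.log r⁻¹))) := by
  have h : S.IsMonogenic F O G := ⟨hF, hO, hOF, hG⟩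
  obtain ⟨s, hs0, hsd, hsum⟩ := h.exists_similarity_dim
  have hd : 0 < d := by exact_mod_cast hs0.trans hsd
  obtain rfl : s = D := (h.minkowskiDim_eq hd hs0 hsd hsum).symm.trans hD
  have hR := h.isRenewalSolution hd hsd hD_gt hsum hmono
  have hfinF := parallelVolume_ne_top h.isBounded_attractor
  have hfinT := innerParallelVolume_ne_top h.isBounded_sUnion_tiling
  have hfinK := outerParallelVolume_ne_top h.isBounded.closure
  have hKlim := HasContent.tendsto hfinK ENNReal.coe_ne_top hK
  rw [ENNReal.coe_toReal] at hKlim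
  set I := ∫ t, logScale (d - s) (innerParallelVolume G) t with hI
  set μ := ∑ n, S.ratio n ^ s * -Real.log (S.ratio n) with hμ
  have hpos : 0 < I / μ := div_pos (h.integral_generator_pos hd hsd hD_gt hmono) hR.mean_pos
  have hadd : ENNReal.ofReal (I / μ + MK) = ENNReal.ofReal (I / μ) + MK := by
    rw [ENNReal.ofReal_add hpos.le MK.coe_nonneg, ENNReal.ofReal_coe_nnreal]
  have hpos' : 0 < ENNReal.ofReal (I / μ) := ENNReal.ofReal_pos.2 hpos
  have hposF : 0 < ENNReal.ofReal (I / μ + MK) :=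
    ENNReal.ofReal_pos.2 (add_pos_of_pos_of_nonneg hpos MK.coe_nonneg)
  have hnonlattice (hS : ¬ S.IsLattice) :
      HasMinkowskiContent s F (ENNReal.ofReal (I / μ + MK)) ∧
        HasTilingMinkowskiContent s (S.tiling O) (ENNReal.ofReal (I / μ)) := by
    have hT := hR.tendsto_of_dense (SelfSimilarSystem.dense_closure_of_not_isLattice hS)
    refine ⟨HasContent.of_tendsto hfinF ?_, HasContent.of_tendsto hfinT hT⟩
    exact (hT.add hKlim).congr fun t => (h.logScale_attractor_eq t).symm
  have hlattice (hS : S.IsLattice) : ¬ ∃ c : ℝ≥0∞, HasMinkowskiContent s F c := by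
    rintro ⟨c, hc⟩
    have hctop : c ≠ ∞ := by
      obtain ⟨C, hC⟩ := h.exists_upper_bound hsd hsum
      refine ne_top_of_le_ne_top ENNReal.ofReal_ne_top
        (le_of_tendsto ((hasContent_iff_tendsto_logScale hfinF).1 hc)
          (b := ENNReal.ofReal C) ?_)
      filter_upwards [eventually_ge_atTop 0] with t ht using ENNReal.ofReal_le_ofReal (hC t ht)
    refine h.not_tendsto_of_isLattice hd hsd hD_gt hsum hmono hS (c.toReal - MK) ?_
    refine ((HasContent.tendsto hfinF hctop hc).sub hKlim).congr fun t => ?_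
    rw [h.logScale_attractor_eq, add_sub_cancel_right]
  refine ⟨⟨?_, fun hS => ?_⟩, fun hS => ?_, fun hS => ⟨hlattice hS, ?_⟩⟩
  · rintro ⟨α, -, -, c, hc, hc0, hctop⟩ hS
    obtain rfl := h.eq_of_hasMinkowskiContent hd hsd hsum hc hc0 hctop
    exact hlattice hS ⟨c, hc⟩
  · exact ⟨s, hs0.le, hsd.le, _, (hnonlattice hS).1, hposF, ENNReal.ofReal_lt_top⟩
  · exact ⟨_, _, (hnonlattice hS).1, (hnonlattice hS).2, hadd, hposF, ENNReal.ofReal_lt_top,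
      hpos', ENNReal.ofReal_lt_top⟩
  · have hintT := intervalIntegrable_logScale (γ := d - s) (monotone_innerParallelVolume _) hfinT
    have hintK := intervalIntegrable_logScale (γ := d - s) (monotone_outerParallelVolume _) hfinK
    refine ⟨_, _, HasAverageContent.of_tendsto (L := I / μ + MK) (monotone_parallelVolume F)
      hfinF ?_, HasAverageContent.of_tendsto (L := I / μ) (monotone_innerParallelVolume _) hfinT
      hR.tendsto_mean, hadd, hposF, ENNReal.ofReal_lt_top, hpos', ENNReal.ofReal_lt_top, ?_⟩
    · refine (hR.tendsto_mean.add (tendsto_integral_mean hintK hKlim)).congr fun T => ?_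
      rw [← add_div, ← intervalIntegral.integral_add (hintT _ _) (hintK _ _)]
      simp only [h.logScale_attractor_eq]
    · intro κ r k hκ hr hk
      have hμk : ∑ n, r ^ ((k n : ℝ) * s) * (k n : ℝ) * Real.log r⁻¹ = μ := by
        refine Finset.sum_congr rfl fun n _ => ?_
        rw [hk, Real.log_zpow, Real.log_inv, Real.rpow_mul hr.le, Real.rpow_intCast]
        ring
      rw [hμk, hI, h.integral_generator hd hsd hD_gt hκ, div_div]
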